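/- All notions are with respect to a matching $M$ in a finite simple graph $G=(V,E)$. A vertex is unmatched if no edge of $M$ is incident to it. An alternating path is a path without repeated vertices (possibly of length $0$) such that of any two consecutive edges exactly one lies in $M$. Let $l_m$ be the minimum length of an alternating path between two distinct unmatched vertices ($l_m=\infty$ if there is none). For a vertex $v$ let $\mathrm{evenlevel}(v)$ (resp. $\mathrm{oddlevel}(v)$) be the minimum length of an even (resp. odd) length alternating path from an unmatched vertex to $v$ ($\infty$ if there is none); every alternating path from an unmatched vertex to $v$ of even (resp. odd) length that attains this minimum is called an $\mathrm{evenlevel}(v)$ (resp. $\mathrm{oddlevel}(v)$) path. The tenacity of $v$ is $t(v)=\mathrm{evenlevel}(v)+\mathrm{oddlevel}(v)$. Let $t(v)<l_m$. For an $\mathrm{evenlevel}(v)$ or $\mathrm{oddlevel}(v)$ path $p$ starting at the unmatched vertex $f$, let $F(p,v)$ be the vertex of tenacity greater than $t(v)$ that is furthest away from $f$ on $p$. The base of $v$, $\mathrm{base}(v)$, is the single element of the set $\{F(p,v) : p \text{ an } \mathrm{evenlevel}(v) \text{ or } \mathrm{oddlevel}(v) \text{ path}\}$. The iterated bases of $v$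 are the vertices $\mathrm{base}^k(v)$, $k\ge 1$, where $\mathrm{base}^1(v)=\mathrm{base}(v)$ and, as long as $t(\mathrm{base}^k(v))<l_m$, $\mathrm{base}^{k+1}(v)=\mathrm{base}(\mathrm{base}^k(v))$. We say that $v$ has all iterated bases defined if, for some $k\ge 1$, $\mathrm{base}^k(v)$ is defined and is an unmatched vertex. Theorem. Let $v$ be a vertex that has all iterated bases defined, and let $p$ be an $\mathrm{evenlevel}(v)$ or $\mathrm{oddlevel}(v)$ path. Then for each vertex $u$ that lies on $p$, all iterated bases of $u$ lie on $p$. -/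

import Mathlib

namespace AltPath

variable {V : Type*} {G : SimpleGraph V}

/-- A vertex is unmatched if no edge of the matching `M` is incident to it. -/
def Unmatched (M : G.Subgraph) (f : V) : Prop := ∀ w, ¬ M.Adj f w

/-- An alternating path: a simple path in `G` (no repeated vertices), possibly of length `0`, such
that of any two consecutive edges exactly one belongs to `M`. -/
def IsAltPath (M : G.Subgraph) {f v : V} (p : G.Walk f v) : Prop :=
  p.IsPath ∧ p.edges.IsChain (fun e e' => (e ∈ M.edgeSet ↔ e' ∉ M.edgeSet))

/-- The length of a minimum even alternating path from an unmatched vertex to `v`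
(`⊤` if there is none). -/
noncomputable def evenlevel (M : G.Subgraph) (v : V) : ℕ∞ :=
  sInf {n : ℕ∞ | ∃ (f : V) (p : G.Walk f v),
    Unmatched M f ∧ IsAltPath M p ∧ Even p.length ∧ n = (p.length : ℕ∞)}

/-- The length of a minimum odd alternating path from an unmatched vertex to `v`
(`⊤` if there is none). -/
noncomputable def oddlevel (M : G.Subgraph) (v : V) : ℕ∞ :=
  sInf {n : ℕ∞ | ∃ (f : V) (p : G.Walk f v),
    Unmatched M f ∧ IsAltPath M p ∧ Odd p.length ∧ n = (p.length : ℕ∞)}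

/-- `p` is an evenlevel(`v`) path. -/
def IsEvenlevelPath (M : G.Subgraph) {f v : V} (p : G.Walk f v) : Prop :=
  Unmatched M f ∧ IsAltPath M p ∧ Even p.length ∧ (p.length : ℕ∞) = evenlevel M v

/-- `p` is an oddlevel(`v`) path. -/
def IsOddlevelPath (M : G.Subgraph) {f v : V} (p : G.Walk f v) : Prop :=
  Unmatched M f ∧ IsAltPath M p ∧ Odd p.length ∧ (p.length : ℕ∞) = oddlevel M v

/-- `p` is an evenlevel(`v`) path or an oddlevel(`v`) path. -/
def IsLevelPath (M : G.Subgraph) {f v : V} (p : G.Walk f v) : Prop :=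
  IsEvenlevelPath M p ∨ IsOddlevelPath M p

/-- The tenacity of a vertex. -/
noncomputable def tenacity (M : G.Subgraph) (v : V) : ℕ∞ := evenlevel M v + oddlevel M v

/-- The length `l_m` of a minimum length augmenting path, i.e. of a minimum length alternating path
between two distinct unmatched vertices (`⊤` if there is none). -/
noncomputable def augLength (M : G.Subgraph) : ℕ∞ :=
  sInf {n : ℕ∞ | ∃ (f g : V) (p : G.Walk f g),
    Unmatched M f ∧ Unmatched M g ∧ f ≠ g ∧ IsAltPath M p ∧ n = (p.length : ℕ∞)}

/-- `b` is the base of `v` with respect to the path `p`: the vertex of tenacity greater than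
`tenacity M v` that is furthest away on `p` from the start of `p`. -/
def IsBaseWrt (M : G.Subgraph) {f v : V} (p : G.Walk f v) (b : V) : Prop :=
  ∃ i ≤ p.length, p.getVert i = b ∧ tenacity M v < tenacity M b ∧
    ∀ j ≤ p.length, i < j → ¬ tenacity M v < tenacity M (p.getVert j)

/-- The set of all bases of `v` with respect to its evenlevel and oddlevel paths. -/
def baseSet (M : G.Subgraph) (v : V) : Set V :=
  {b | ∃ (f : V) (p : G.Walk f v), IsLevelPath M p ∧ IsBaseWrt M p b}

/-- `b` is the base of `v`: `v` has tenacity less than `l_m` and `b` is the single element of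
`baseSet M v`. -/
def IsBase (M : G.Subgraph) (v b : V) : Prop :=
  tenacity M v < augLength M ∧ baseSet M v = {b}

/-- `IsIterBase M k v b`: the `k`-th iterate `base^k(v)` is defined and equals `b`. -/
def IsIterBase (M : G.Subgraph) : ℕ → V → V → Prop
  | 0, v, b => b = v
  | k + 1, v, b => ∃ c, IsIterBase M k v c ∧ IsBase M c b

/-- `v` has all iterated bases defined: for some `k ≥ 1`, `base^k(v)` is an unmatched vertex. -/
def HasAllIterBases (M : G.Subgraph) (v : V) : Prop :=
  ∃ k : ℕ, 1 ≤ k ∧ ∃ b, IsIterBase M k v b ∧ Unmatched M b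

end AltPath

/-!
The theorem is proved by linear programming duality, following Edmonds' search for augmenting paths.

Encode the matching by the involution `m` that sends each vertex to its mate. An even alternating
path from an unmatched vertex `f` to `x` amounts to a matching `n` (the symmetric difference) that
misses `x` instead of `f`, and its length is the number `cost m n` of vertices covered by edges of
`n` outside `m`. Shortest alternating paths are therefore optimal solutions of weighted matching
problems, for which there are dual solutions: vertex duals `y`, and nonnegative duals on odd sets.
`dual G m Δ` is the dual solution after `Δ` adjustments. A vertex is `Outer` if some matching of the
size of `m` and of zero duality gap (`gap`) misses it, and the blossoms (`blossom`) are the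
connected components of the graph of tight edges between outer vertices. One adjustment lowers `y`
on outer vertices, raises it on their mates that are not outer, and raises the dual of each blossom.

That this produces feasible duals as long as no augmenting path is shorter than `2 * Δ`
(`dual_invariant`) rests on two facts. A tight edge leads from an outer vertex only to outer vertices
and mates of outer vertices (`IsOptimal.outer_mate_of_tight`). And in each blossom at most one vertex,
its deficit, is not matched within the blossom (`IsOptimal.atMostOneDeficit`), which makes `weak_duality`
work. Both are the Gallai–Edmonds structure theory (`IsOptimal.stability`, `IsOptimal.gallai`) for
matchings of zero gap. It uses only the exchange of two matchings along a component of their symmetric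
difference (`exchange`): the gap is additive under such exchanges and nonnegative, so matchings of zero
gap are closed under them.

The evenlevel of an outer vertex `x` is then `y x + Δ - 1`, and a vertex has tenacity less than
`2 * Δ` exactly if it and its mate are outer after `Δ` adjustments (`tenacity_add_one_le_iff`).

Now let `p` be a level path of `v`, and let `u` lie on `p`. If `u` has at least the tenacity of `v`, then
the part of `p` up to `u` is a level path of `u` (`IsLevelPath.take`), so it contains the base
of `u`. Otherwise let `2 * s - 1` be the tenacity of `u`. The base of `u` is the deficit of
the blossom that contains `u` after `s` adjustments (`IsBaseWrt.isDeficit`). By complementary slackness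
the matching obtained from `p` also has at most one deficit in that blossom, and this forces `p`
through the base (`deficit_mem_support`). Iterating gives the theorem.
-/

namespace AltPath

/-! ### Matchings as involutions and their symmetric differences -/

section Involutions

variable {V : Type*}

/-- A matching of `G`, encoded as the involution that sends a covered vertex to its mate and fixes
the vertices that are not covered. -/
structure IsMate (G : SimpleGraph V) (n : V → V) : Prop where
  invol : ∀ v, n (n v) = v
  adj : ∀ v, n v ≠ v → G.Adj v (n v)

/-- The walk that starts at `f` and applies the involutions `n` and `m` alternately, `n` first. -/
def zigzag (n m : V → V) (f : V) : ℕ → V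
  | 0 => f
  | i + 1 => if Even i then n (zigzag n m f i) else m (zigzag n m f i)

/-- `a 0, …, a ℓ` are distinct, and `n` and `m` alternately map each of them to the next one. -/
structure IsZigzag (n m : V → V) (a : ℕ → V) (ℓ : ℕ) : Prop where
  inj : ∀ i ≤ ℓ, ∀ j ≤ ℓ, a i = a j → i = j
  even : ∀ i < ℓ, Even i → n (a i) = a (i + 1)
  odd : ∀ i < ℓ, Odd i → m (a i) = a (i + 1)

/-- The component of the symmetric difference of two matchings at a vertex missed by one of them
is a path. -/
theorem exists_isZigzag [Finite V] {n m : V → V} (hn : ∀ v, n (n v) = v) (hm : ∀ v, m (m v) = v)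
    {f : V} (hf : m f = f) :
    ∃ a ℓ, IsZigzag n m a ℓ ∧ a 0 = f ∧
      ((Even ℓ ∧ n (a ℓ) = a ℓ) ∨ (Odd ℓ ∧ m (a ℓ) = a ℓ)) := by
  classical
  set a := zigzag n m f with ha
  have h0 : a 0 = f := rfl
  have hev : ∀ i, Even i → n (a i) = a (i + 1) := fun i hi => by simp [ha, zigzag, hi]
  have hod : ∀ i, Odd i → m (a i) = a (i + 1) := fun i hi => by
    simp [ha, zigzag, Nat.not_even_iff_odd.2 hi]
  have hev' : ∀ i, Even i → n (a (i + 1)) = a i := fun i hi => by rw [← hev i hi, hn]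
  have hod' : ∀ i, Odd i → m (a (i + 1)) = a i := fun i hi => by rw [← hod i hi, hm]
  -- A new vertex repeats an old one only if the walk has come to a stop.
  have key : ∀ ℓ, (∀ i < ℓ, a (i + 1) ≠ a i) → ∀ j ≤ ℓ, ∀ i < j, a i ≠ a j := by
    intro ℓ hℓ j
    induction j using Nat.strong_induction_on with
    | _ j ih =>
      intro hj i hij heq
      obtain ⟨k, rfl⟩ : ∃ k, j = k + 1 := ⟨j - 1, by omega⟩
      have hstep : i ≠ k := fun h => hℓ k (by omega) (by rw [← heq, h])
      have hik : i < k := by omega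
      rcases Nat.even_or_odd k with hk | hk
      · have h1 : n (a i) = a k := by rw [heq, hev' k hk]
        rcases Nat.even_or_odd i with hi | hi
        · rw [hev i hi] at h1
          have : i + 1 ≠ k := fun h => by
            have := hi.add_one; rw [h] at this; exact (Nat.not_even_iff_odd.2 this) hk
          exact ih k (by omega) (by omega) (i + 1) (by omega) h1
        · obtain ⟨i', rfl⟩ : ∃ i', i = i' + 1 := ⟨i - 1, by have := hi.pos; omega⟩
          have hi' : Even i' := by
            rcases Nat.even_or_odd i' with h | h
            · exact h
            · exact absurd hi (Nat.not_odd_iff_even.2 h.add_one)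
          rw [hev' i' hi'] at h1
          exact ih k (by omega) (by omega) i' (by omega) h1
      · have h1 : m (a i) = a k := by rw [heq, hod' k hk]
        rcases Nat.even_or_odd i with hi | hi
        · rcases Nat.eq_zero_or_pos i with rfl | hpos
          · rw [h0, hf, ← h0] at h1
            exact ih k (by omega) (by omega) 0 (by omega) h1
          · obtain ⟨i', rfl⟩ : ∃ i', i = i' + 1 := ⟨i - 1, by omega⟩
            have hi' : Odd i' := by
              rcases Nat.even_or_odd i' with h | h
              · exact absurd hi (Nat.not_even_iff_odd.2 h.add_one)
              · exact h
            rw [hod' i' hi'] at h1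
            exact ih k (by omega) (by omega) i' (by omega) h1
        · rw [hod i hi] at h1
          have : i + 1 ≠ k := fun h => by
            have := hi.add_one; rw [h] at this; exact (Nat.not_even_iff_odd.2 hk) this
          exact ih k (by omega) (by omega) (i + 1) (by omega) h1
  have hex : ∃ ℓ, a (ℓ + 1) = a ℓ := by
    by_contra hcon
    push Not at hcon
    have : Function.Injective a := by
      intro i j hij
      by_contra hne
      rcases Nat.lt_or_gt_of_ne hne with h | h
      · exact key j (fun i _ => hcon i) j le_rfl i h hij
      · exact key i (fun i _ => hcon i) i le_rfl j h hij.symm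
    exact not_injective_infinite_finite a this
  refine ⟨a, Nat.find hex, ⟨?_, fun i _ => hev i, fun i _ => hod i⟩, h0, ?_⟩
  · intro i hi j hj hij
    by_contra hne
    have hk := key (Nat.find hex) (fun i hi => Nat.find_min hex hi)
    rcases Nat.lt_or_gt_of_ne hne with h | h
    · exact hk j hj i h hij
    · exact hk i hi j h hij.symm
  · have hs := Nat.find_spec hex
    rcases Nat.even_or_odd (Nat.find hex) with h | h
    · exact .inl ⟨h, by rw [hev _ h, hs]⟩
    · exact .inr ⟨h, by rw [hod _ h, hs]⟩

namespace IsZigzag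

variable {n m : V → V} {a : ℕ → V} {ℓ : ℕ}

theorem even_succ (h : IsZigzag n m a ℓ) (hn : ∀ v, n (n v) = v) {i : ℕ} (hi : i < ℓ)
    (he : Even i) : n (a (i + 1)) = a i := by rw [← h.even i hi he, hn]

theorem odd_succ (h : IsZigzag n m a ℓ) (hm : ∀ v, m (m v) = v) {i : ℕ} (hi : i < ℓ)
    (ho : Odd i) : m (a (i + 1)) = a i := by rw [← h.odd i hi ho, hm]

theorem fst_ne (h : IsZigzag n m a ℓ) (hn : ∀ v, n (n v) = v) {i : ℕ} (hi : i ≤ ℓ)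
    (hlast : i = ℓ → Odd i) : n (a i) ≠ a i := by
  intro heq
  rcases Nat.even_or_odd i with he | ho
  · have hlt : i < ℓ := lt_of_le_of_ne hi fun h => Nat.not_even_iff_odd.2 (hlast h) he
    rw [h.even i hlt he] at heq
    exact absurd (h.inj _ (by omega) _ (by omega) heq) (by omega)
  · obtain ⟨j, rfl⟩ : ∃ j, i = j + 1 := ⟨i - 1, by have := ho.pos; omega⟩
    have hj : Even j := by
      by_contra hc; exact Nat.not_even_iff_odd.2 ho (Nat.not_even_iff_odd.1 hc).add_one
    rw [h.even_succ hn (by omega) hj] at heq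
    exact absurd (h.inj _ (by omega) _ (by omega) heq) (by omega)

theorem snd_ne (h : IsZigzag n m a ℓ) (hm : ∀ v, m (m v) = v) {i : ℕ} (hi : i ≤ ℓ)
    (h0 : i ≠ 0) (hlast : i = ℓ → Even i) : m (a i) ≠ a i := by
  intro heq
  rcases Nat.even_or_odd i with he | ho
  · obtain ⟨j, rfl⟩ : ∃ j, i = j + 1 := ⟨i - 1, by omega⟩
    have hj : Odd j := by
      by_contra hc; exact Nat.not_odd_iff_even.2 he (Nat.not_odd_iff_even.1 hc).add_one
    rw [h.odd_succ hm (by omega) hj] at heq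
    exact absurd (h.inj _ (by omega) _ (by omega) heq) (by omega)
  · have hlt : i < ℓ := lt_of_le_of_ne hi fun h => Nat.not_even_iff_odd.2 ho (hlast h)
    rw [h.odd i hlt ho] at heq
    exact absurd (h.inj _ (by omega) _ (by omega) heq) (by omega)

theorem fst_ne_snd (h : IsZigzag n m a ℓ) (hn : ∀ v, n (n v) = v) (hm : ∀ v, m (m v) = v)
    (h0 : m (a 0) = a 0) {i : ℕ} (hi : i < ℓ) : n (a i) ≠ m (a i) := by
  intro heq
  rcases Nat.even_or_odd i with he | ho
  · rw [h.even i hi he] at heq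
    rcases Nat.eq_zero_or_pos i with rfl | hpos
    · rw [h0] at heq
      exact absurd (h.inj _ (by omega) _ (by omega) heq) (by omega)
    · obtain ⟨j, rfl⟩ : ∃ j, i = j + 1 := ⟨i - 1, by omega⟩
      have hj : Odd j := by
        by_contra hc; exact Nat.not_odd_iff_even.2 he (Nat.not_odd_iff_even.1 hc).add_one
      rw [h.odd_succ hm (by omega) hj] at heq
      exact absurd (h.inj _ (by omega) _ (by omega) heq) (by omega)
  · rw [h.odd i hi ho] at heq
    obtain ⟨j, rfl⟩ : ∃ j, i = j + 1 := ⟨i - 1, by have := ho.pos; omega⟩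
    have hj : Even j := by
      by_contra hc; exact Nat.not_even_iff_odd.2 ho (Nat.not_even_iff_odd.1 hc).add_one
    rw [h.even_succ hn (by omega) hj] at heq
    exact absurd (h.inj _ (by omega) _ (by omega) heq) (by omega)

/-- The vertex set of a maximal zigzag is closed under both involutions. -/
theorem closed (h : IsZigzag n m a ℓ) (hn : ∀ v, n (n v) = v) (hm : ∀ v, m (m v) = v)
    (h0 : m (a 0) = a 0) (hend : (Even ℓ ∧ n (a ℓ) = a ℓ) ∨ (Odd ℓ ∧ m (a ℓ) = a ℓ))
    {i : ℕ} (hi : i ≤ ℓ) : (∃ j ≤ ℓ, n (a i) = a j) ∧ ∃ j ≤ ℓ, m (a i) = a j := by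
  rcases Nat.even_or_odd i with he | ho
  · constructor
    · rcases hi.lt_or_eq with hlt | rfl
      · exact ⟨i + 1, hlt, h.even i hlt he⟩
      · rcases hend with ⟨-, h1⟩ | ⟨h1, -⟩
        · exact ⟨i, le_rfl, h1⟩
        · exact absurd he (Nat.not_even_iff_odd.2 h1)
    · rcases Nat.eq_zero_or_pos i with rfl | hpos
      · exact ⟨0, by omega, h0⟩
      · obtain ⟨j, rfl⟩ : ∃ j, i = j + 1 := ⟨i - 1, by omega⟩
        have hj : Odd j := by
          by_contra hc; exact Nat.not_odd_iff_even.2 he (Nat.not_odd_iff_even.1 hc).add_one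
        exact ⟨j, by omega, h.odd_succ hm (by omega) hj⟩
  · constructor
    · obtain ⟨j, rfl⟩ : ∃ j, i = j + 1 := ⟨i - 1, by have := ho.pos; omega⟩
      have hj : Even j := by
        by_contra hc; exact Nat.not_even_iff_odd.2 ho (Nat.not_even_iff_odd.1 hc).add_one
      exact ⟨j, by omega, h.even_succ hn (by omega) hj⟩
    · rcases hi.lt_or_eq with hlt | rfl
      · exact ⟨i + 1, hlt, h.odd i hlt ho⟩
      · rcases hend with ⟨h1, -⟩ | ⟨-, h1⟩
        · exact absurd h1 (Nat.not_even_iff_odd.2 ho)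
        · exact ⟨i, le_rfl, h1⟩

end IsZigzag

open Classical in
/-- The matching that agrees with `n'` on `K` and with `n` elsewhere. -/
noncomputable def swap (K : Set V) (n n' : V → V) (v : V) : V := if v ∈ K then n' v else n v

theorem IsMate.swap {G : SimpleGraph V} {n n' : V → V} {K : Set V} (hn : IsMate G n)
    (hn' : IsMate G n') (hK : ∀ v ∈ K, n v ∈ K) (hK' : ∀ v ∈ K, n' v ∈ K) :
    IsMate G (swap K n n') := by
  have hc : ∀ v, v ∉ K → n v ∉ K := fun v hv h => hv (by simpa [hn.invol] using hK _ h)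
  refine ⟨fun v => ?_, fun v => ?_⟩
  · by_cases h : v ∈ K
    · simp [AltPath.swap, h, hK' v h, hn'.invol]
    · simp [AltPath.swap, h, hc v h, hn.invol]
  · by_cases h : v ∈ K
    · simpa [AltPath.swap, h] using hn'.adj v
    · simpa [AltPath.swap, h] using hn.adj v

/-- Exchange property. Swapping two matchings along the component of their symmetric difference at
a vertex `x` missed by `n₂` only either trades `x` for a vertex `e` missed by `n₁` only, or
shows an augmenting path for `n₂` from `x` to another vertex missed by `n₂`. -/
theorem exchange [Finite V] {G : SimpleGraph V} {n₁ n₂ : V → V} (h₁ : IsMate G n₁)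
    (h₂ : IsMate G n₂) {x : V} (hx : n₂ x = x) (hx' : n₁ x ≠ x) :
    ∃ n₁' n₂', IsMate G n₁' ∧ IsMate G n₂' ∧
      (∀ v, (n₁' v = n₁ v ∧ n₂' v = n₂ v) ∨ (n₁' v = n₂ v ∧ n₂' v = n₁ v)) ∧
      ((∃ e, n₁ e = e ∧ n₂ e ≠ e ∧ (∀ v, n₁' v = v ↔ v = x ∨ (n₁ v = v ∧ v ≠ e)) ∧
          ∀ v, n₂' v = v ↔ v = e ∨ (n₂ v = v ∧ v ≠ x)) ∨
        ∃ a ℓ, IsZigzag n₁ n₂ a ℓ ∧ Odd ℓ ∧ a 0 = x ∧ n₂ (a ℓ) = a ℓ ∧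
          (∀ i ≤ ℓ, n₂' (a i) = n₁ (a i)) ∧
          ∀ v, n₂' v = v ↔ n₂ v = v ∧ v ≠ x ∧ v ≠ a ℓ) := by
  obtain ⟨a, ℓ, hz, h0, hend⟩ := exists_isZigzag h₁.invol h₂.invol hx
  have h00 : n₂ (a 0) = a 0 := by rw [h0, hx]
  have hcl := fun i (hi : i ≤ ℓ) => hz.closed h₁.invol h₂.invol h00 hend hi
  set K : Set V := {v | ∃ i ≤ ℓ, v = a i} with hK
  have hK1 : ∀ v ∈ K, n₁ v ∈ K := by
    rintro v ⟨i, hi, rfl⟩; exact (hcl i hi).1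
  have hK2 : ∀ v ∈ K, n₂ v ∈ K := by
    rintro v ⟨i, hi, rfl⟩; exact (hcl i hi).2
  have hmem : ∀ i ≤ ℓ, a i ∈ K := fun i hi => ⟨i, hi, rfl⟩
  have hxK : x ∈ K := h0 ▸ hmem 0 (by omega)
  refine ⟨swap K n₁ n₂, swap K n₂ n₁, h₁.swap h₂ hK1 hK2, h₂.swap h₁ hK2 hK1, fun v => ?_, ?_⟩
  · by_cases h : v ∈ K <;> simp [swap, h]
  rcases hend with ⟨hev, hfix⟩ | ⟨hod, hfix⟩
  · left
    have hℓ : ℓ ≠ 0 := by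
      rintro rfl; rw [h0] at hfix; exact hx' hfix
    have hf1 : ∀ v ∈ K, n₁ v = v ↔ v = a ℓ := by
      rintro v ⟨i, hi, rfl⟩
      refine ⟨fun h => ?_, fun h => by rw [h, hfix]⟩
      by_contra hne
      exact hz.fst_ne h₁.invol hi (fun h => absurd (by rw [h]) hne) h
    have hf2 : ∀ v ∈ K, n₂ v = v ↔ v = x := by
      rintro v ⟨i, hi, rfl⟩
      refine ⟨fun h => ?_, fun h => by rw [h, hx]⟩
      by_contra hne
      exact hz.snd_ne h₂.invol hi (fun h => hne (by rw [h, h0])) (fun h => h ▸ hev) h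
    refine ⟨a ℓ, hfix, hz.snd_ne h₂.invol le_rfl hℓ (fun _ => hev), fun v => ?_, fun v => ?_⟩
    · by_cases h : v ∈ K
      · simp only [swap, h, if_true, hf2 v h, hf1 v h]; tauto
      · have h1 : v ≠ x := fun e => h (e ▸ hxK)
        have h2 : v ≠ a ℓ := fun e => h (e ▸ hmem ℓ le_rfl)
        simp [swap, h, h1, h2]
    · by_cases h : v ∈ K
      · simp only [swap, h, if_true, hf2 v h, hf1 v h]; tauto
      · have h1 : v ≠ x := fun e => h (e ▸ hxK)
        have h2 : v ≠ a ℓ := fun e => h (e ▸ hmem ℓ le_rfl)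
        simp [swap, h, h1, h2]
  · right
    have hf1 : ∀ v ∈ K, n₁ v ≠ v := by
      rintro v ⟨i, hi, rfl⟩
      exact hz.fst_ne h₁.invol hi (fun h => h ▸ hod)
    have hf2 : ∀ v ∈ K, n₂ v = v → v = x ∨ v = a ℓ := by
      rintro v ⟨i, hi, rfl⟩ h
      by_contra hne
      push Not at hne
      exact hz.snd_ne h₂.invol hi (fun h => hne.1 (by rw [h, h0]))
        (fun h => absurd (by rw [h]) hne.2) h
    refine ⟨a, ℓ, hz, hod, h0, hfix, fun i hi => by simp [swap, hmem i hi], fun v => ?_⟩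
    by_cases h : v ∈ K
    · have := hf1 v h; have := hf2 v h
      simp only [swap, h, if_true]; tauto
    · have h1 : v ≠ x := fun e => h (e ▸ hxK)
      have h2 : v ≠ a ℓ := fun e => h (e ▸ hmem ℓ le_rfl)
      simp [swap, h, h1, h2]

theorem even_card_of_fixedPointFree_involution {s : Finset V} {n : V → V} (hn : ∀ v, n (n v) = v)
    (hs : ∀ v ∈ s, n v ∈ s) (hne : ∀ v ∈ s, n v ≠ v) : Even s.card := by
  have h : ∑ v ∈ s, (1 : ZMod 2) = 0 :=
    Finset.sum_involution (fun v _ => n v) (fun _ _ => by decide) (fun v hv _ => hne v hv)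
      hs (fun v _ => hn v)
  rw [Finset.sum_const, nsmul_eq_mul, mul_one] at h
  exact (ZMod.natCast_eq_zero_iff_even).1 h

end Involutions

section Edges

variable {V : Type*} [DecidableEq V] {G : SimpleGraph V} {n : V → V}

/-- The matching `n` without the edge at `a`. -/
def removeEdge (n : V → V) (a : V) (v : V) : V := if v = a ∨ v = n a then v else n v

theorem IsMate.removeEdge (hn : IsMate G n) (a : V) : IsMate G (removeEdge n a) := by
  have hinv := hn.invol
  refine ⟨fun v => ?_, fun v => ?_⟩
  · by_cases h : v = a ∨ v = n a
    · simp [AltPath.removeEdge, h]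
    · have : ¬ (n v = a ∨ n v = n a) := by
        rintro (h' | h')
        · exact h (.inr (by rw [← h', hinv]))
        · exact h (.inl (by rw [← hinv v, h', hinv]))
      simp [AltPath.removeEdge, h, this, hinv]
  · by_cases h : v = a ∨ v = n a
    · simp [AltPath.removeEdge, h]
    · simpa [AltPath.removeEdge, h] using hn.adj v

theorem removeEdge_eq_self_iff (a v : V) : removeEdge n a v = v ↔ n v = v ∨ v = a ∨ v = n a := by
  by_cases h : v = a ∨ v = n a
  · simp [removeEdge, h]
  · simp [removeEdge, h]

/-- The matching `n` with the edge between the uncovered vertices `a` and `b` added. -/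
def addEdge (n : V → V) (a b : V) (v : V) : V := if v = a then b else if v = b then a else n v

theorem IsMate.addEdge (hn : IsMate G n) {a b : V} (ha : n a = a) (hb : n b = b)
    (hab : G.Adj a b) : IsMate G (addEdge n a b) := by
  have hinv := hn.invol
  have hne := hab.ne
  refine ⟨fun v => ?_, fun v => ?_⟩
  · by_cases h : v = a
    · subst h; simp [AltPath.addEdge]
    · by_cases h' : v = b
      · subst h'; simp [AltPath.addEdge, h]
      · have h1 : n v ≠ a := fun e => h (by rw [← hinv v, e, ha])
        have h2 : n v ≠ b := fun e => h' (by rw [← hinv v, e, hb])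
        simp [AltPath.addEdge, h, h', h1, h2, hinv]
  · by_cases h : v = a
    · subst h; simpa [AltPath.addEdge] using fun _ => hab
    · by_cases h' : v = b
      · subst h'; simpa [AltPath.addEdge, h] using fun _ => hab.symm
      · simpa [AltPath.addEdge, h, h'] using hn.adj v

theorem addEdge_eq_self_iff {a b : V} (hab : a ≠ b) (v : V) :
    addEdge n a b v = v ↔ n v = v ∧ v ≠ a ∧ v ≠ b := by
  by_cases h : v = a
  · subst h; simp [addEdge, hab.symm]
  · by_cases h' : v = b
    · subst h'; simp [addEdge, h, hab]
    · simp [addEdge, h, h']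

theorem addEdge_removeEdge (hn : ∀ v, n (n v) = v) {a : V} (ha : n a ≠ a) :
    addEdge (removeEdge n a) a (n a) = n := by
  funext v
  by_cases h : v = a
  · simp [addEdge, h]
  · by_cases h' : v = n a
    · subst h'; simp [addEdge, hn, ha]
    · simp [addEdge, removeEdge, h, h']

end Edges

section FixCard

variable {V : Type*} [Fintype V] [DecidableEq V] {G : SimpleGraph V} {n : V → V}

/-- The number of vertices that the matching `n` does not cover. -/
def fixCard (n : V → V) : ℕ := (Finset.univ.filter fun v => n v = v).card

theorem even_fixCard_add (hn : ∀ v, n (n v) = v) : Even (fixCard n + Fintype.card V) := by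
  have h : Even (Finset.univ.filter fun v => ¬ n v = v).card :=
    even_card_of_fixedPointFree_involution hn (fun v => by simp [hn, eq_comm])
      (fun v hv => by simpa using hv)
  have h2 := Finset.card_filter_add_card_filter_not (s := Finset.univ) (fun v => n v = v)
  rw [Finset.card_univ] at h2
  rw [← h2, ← add_assoc]
  exact (Even.add_self _).add h

theorem fixCard_le_of_imp {n n' : V → V} (h : ∀ v, n' v = v → n v = v) :
    fixCard n' ≤ fixCard n :=
  Finset.card_le_card fun v => by simpa using h v

theorem fixCard_exchange {n n' : V → V} {x e : V} (he : n e = e) (hx : n x ≠ x)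
    (h : ∀ v, n' v = v ↔ v = x ∨ (n v = v ∧ v ≠ e)) : fixCard n' = fixCard n := by
  have : (Finset.univ.filter fun v => n' v = v)
      = Insert.insert x ((Finset.univ.filter fun v => n v = v).erase e) := by
    ext v; simp [h]; tauto
  rw [fixCard, this, Finset.card_insert_of_notMem (by simp [hx]),
    Finset.card_erase_add_one (by simpa using he), fixCard]

theorem fixCard_removeEdge (hn : IsMate G n) {a : V} (ha : n a ≠ a) :
    fixCard (removeEdge n a) = fixCard n + 2 := by
  have : (Finset.univ.filter fun v => removeEdge n a v = v)
      = Insert.insert a (Insert.insert (n a) (Finset.univ.filter fun v => n v = v)) := by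
    ext v; simp [removeEdge_eq_self_iff]; tauto
  rw [fixCard, this, Finset.card_insert_of_notMem, Finset.card_insert_of_notMem, fixCard]
  · simpa [hn.invol] using ha.symm
  · simpa [ha] using ha.symm

theorem fixCard_addEdge {a b : V} (ha : n a = a) (hb : n b = b) (hab : a ≠ b) :
    fixCard (addEdge n a b) + 2 = fixCard n := by
  have : (Finset.univ.filter fun v => n v = v)
      = Insert.insert a (Insert.insert b (Finset.univ.filter fun v => addEdge n a b v = v)) := by
    ext v
    simp only [addEdge_eq_self_iff hab, Finset.mem_filter, Finset.mem_univ, true_and,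
      Finset.mem_insert]
    constructor
    · tauto
    · rintro (rfl | rfl | h)
      exacts [ha, hb, h.1]
  rw [fixCard, fixCard, this, Finset.card_insert_of_notMem, Finset.card_insert_of_notMem]
  · simp [addEdge_eq_self_iff hab]
  · simp [addEdge_eq_self_iff hab, hab]

end FixCard

/-! ### Dual solutions and weak duality -/

section Duality

variable {V : Type*} [Fintype V] [DecidableEq V] {G : SimpleGraph V} {m n : V → V}
  {y : V → ℤ} {z : V → V → ℤ}

/-- The contribution of a vertex `v` with mate `w` to `gap`. -/
def psi (m : V → V) (y : V → ℤ) (v w : V) : ℤ :=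
  if w = v then 1 - y v else if w = m v then 0 else 1

/-- The duality gap of the matching `n` with respect to the vertex duals `y`, for the problem of
finding matchings with few edges outside `m`. It equals the number of vertices that `n` covers
by edges outside `m`, plus the sum of `y - 1` over the vertices missed by `m`, minus the sum of
`y - 1` over the vertices missed by `n`. -/
def gap (m : V → V) (y : V → ℤ) (n : V → V) : ℤ := ∑ v, (psi m y v (n v) - psi m y v (m v))

/-- The slack of the edge `uw` with respect to vertex duals `y` and blossom duals that add up to
`2 * z u w` over all blossoms containing both `u` and `w`. -/
def slack (m : V → V) (y : V → ℤ) (z : V → V → ℤ) (u w : V) : ℤ :=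
  y u + y w + 2 * z u w - if w = m u then 2 else 0

theorem gap_self : gap m y m = 0 := by simp [gap]

theorem gap_add_gap {n₁ n₂ n₁' n₂' : V → V}
    (h : ∀ v, (n₁' v = n₁ v ∧ n₂' v = n₂ v) ∨ (n₁' v = n₂ v ∧ n₂' v = n₁ v)) :
    gap m y n₁' + gap m y n₂' = gap m y n₁ + gap m y n₂ := by
  simp only [gap, ← Finset.sum_add_distrib]
  refine Finset.sum_congr rfl fun v _ => ?_
  rcases h v with ⟨h1, h2⟩ | ⟨h1, h2⟩ <;> rw [h1, h2]
  ring

theorem gap_addEdge (hm : ∀ v, m (m v) = v) {a b : V} (ha : n a = a) (hb : n b = b)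
    (hab : a ≠ b) :
    gap m y (addEdge n a b) = gap m y n + (y a + y b - if b = m a then 2 else 0) := by
  rw [← sub_eq_iff_eq_add']
  have hiff : a = m b ↔ b = m a := ⟨fun h => by rw [h, hm], fun h => by rw [h, hm]⟩
  have : gap m y (addEdge n a b) - gap m y n
      = ∑ v ∈ {a, b}, (psi m y v (addEdge n a b v) - psi m y v (n v)) := by
    rw [gap, gap, ← Finset.sum_sub_distrib]
    rw [← Finset.sum_subset (Finset.subset_univ {a, b})]
    · exact Finset.sum_congr rfl fun v _ => by ring
    · intro v _ hv
      simp only [Finset.mem_insert, Finset.mem_singleton, not_or] at hv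
      simp [addEdge, hv.1, hv.2]
  rw [this, Finset.sum_pair hab]
  simp only [addEdge, psi, ha, hb, hab, hab.symm, if_true, if_false, hiff]
  split_ifs <;> ring

theorem gap_removeEdge (hm : ∀ v, m (m v) = v) (hn : ∀ v, n (n v) = v) {a : V} (ha : n a ≠ a) :
    gap m y (removeEdge n a) = gap m y n - (y a + y (n a) - if n a = m a then 2 else 0) := by
  have h := gap_addEdge (n := removeEdge n a) (y := y) hm (a := a) (b := n a)
    (by simp [removeEdge]) (by simp [removeEdge]) ha.symm
  rw [addEdge_removeEdge hn ha] at h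
  linarith

/-- `v` is a deficit of `n` with respect to `r` if `n` does not match `v` within its class. -/
def IsDeficit (r : V → V → Prop) (n : V → V) (v : V) : Prop := n v = v ∨ ¬ r v (n v)

/-- Every class of `r` contains at most one deficit of `n`. -/
def AtMostOneDeficit (r : V → V → Prop) (n : V → V) : Prop :=
  ∀ x y, r x y → IsDeficit r n x → IsDeficit r n y → x = y

open Classical in
/-- The vertices that `n` matches within their own class. -/
noncomputable def innerMatched (r : V → V → Prop) (n : V → V) : Finset V :=
  Finset.univ.filter fun v => ¬ IsDeficit r n v

open Classical in
theorem card_innerMatched_class_le (S : Setoid V) (hm : ∀ v, m (m v) = v)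
    (hn : ∀ v, n (n v) = v) (hU : AtMostOneDeficit S.r m) (c : Quotient S) :
    ((innerMatched S.r n).filter fun v => Quotient.mk S v = c).card ≤
        ((innerMatched S.r m).filter fun v => Quotient.mk S v = c).card ∧
      (((innerMatched S.r n).filter fun v => Quotient.mk S v = c).card =
        ((innerMatched S.r m).filter fun v => Quotient.mk S v = c).card →
        ∀ x₁ x₂, Quotient.mk S x₁ = c → Quotient.mk S x₂ = c → IsDeficit S.r n x₁ →
          IsDeficit S.r n x₂ → x₁ = x₂) := by
  have hev : ∀ k : V → V, (∀ v, k (k v) = v) →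
      Even ((innerMatched S.r k).filter fun v => Quotient.mk S v = c).card := by
    intro k hk
    refine even_card_of_fixedPointFree_involution hk (fun v hv => ?_) (fun v hv => ?_)
    · simp only [innerMatched, IsDeficit, Finset.mem_filter, Finset.mem_univ, true_and, not_or,
        not_not] at hv ⊢
      obtain ⟨⟨h1, h2⟩, h3⟩ := hv
      refine ⟨⟨by rw [hk]; exact fun e => h1 e.symm, by rw [hk]; exact S.symm h2⟩, ?_⟩
      rw [← h3]; exact Quotient.sound (S.symm h2)
    · simp only [innerMatched, IsDeficit, Finset.mem_filter, Finset.mem_univ, true_and, not_or,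
        not_not] at hv
      exact hv.1.1
  set C := Finset.univ.filter fun v => Quotient.mk S v = c with hC
  set D : (V → V) → Finset V := fun k => C.filter fun v => IsDeficit S.r k v with hD
  have hsplit : ∀ k : V → V, ((innerMatched S.r k).filter fun v => Quotient.mk S v = c).card
      + (D k).card = C.card := by
    intro k
    rw [← Finset.card_filter_add_card_filter_not (s := C) (fun v => IsDeficit S.r k v), add_comm]
    congr 2
    ext v; simp [innerMatched, hC, and_comm]
  have hDm : (D m).card ≤ 1 := by
    rw [Finset.card_le_one]
    intro a ha b hb
    simp only [hD, hC, Finset.mem_filter, Finset.mem_univ, true_and] at ha hb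
    exact hU a b (Quotient.exact (ha.1.trans hb.1.symm)) ha.2 hb.2
  have h1 := hsplit m
  have h2 := hsplit n
  obtain ⟨i, hi⟩ := hev m hm
  obtain ⟨j, hj⟩ := hev n hn
  refine ⟨by omega, fun heq x₁ x₂ hx₁ hx₂ hd₁ hd₂ => ?_⟩
  have hDn : (D n).card ≤ 1 := by omega
  rw [Finset.card_le_one] at hDn
  exact hDn x₁ (by simp [hD, hC, hx₁, hd₁]) x₂ (by simp [hD, hC, hx₂, hd₂])

theorem card_innerMatched_le (S : Setoid V) (hm : ∀ v, m (m v) = v) (hn : ∀ v, n (n v) = v)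
    (hU : AtMostOneDeficit S.r m) :
    (innerMatched S.r n).card ≤ (innerMatched S.r m).card ∧
      ((innerMatched S.r n).card = (innerMatched S.r m).card → AtMostOneDeficit S.r n) := by
  classical
  have hc := card_innerMatched_class_le S hm hn hU
  have hsum : ∀ k : V → V, (innerMatched S.r k).card
      = ∑ c : Quotient S, ((innerMatched S.r k).filter fun v => Quotient.mk S v = c).card :=
    fun k => Finset.card_eq_sum_card_fiberwise (fun _ _ => Finset.mem_univ _)
  rw [hsum n, hsum m]
  refine ⟨Finset.sum_le_sum fun c _ => (hc c).1, fun heq x y hxy hx hy => ?_⟩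
  have := (Finset.sum_eq_sum_iff_of_le fun c _ => (hc c).1).1 heq (Quotient.mk S x)
    (Finset.mem_univ _)
  exact (hc _).2 this x y rfl (Quotient.sound (S.symm hxy)) hx hy

/-- Twice the sum of `psi` over a matching, up to a constant, in terms of slacks. -/
theorem two_mul_sum_psi (hm : ∀ v, m (m v) = v) (hn : ∀ v, n (n v) = v) :
    2 * ∑ v, (psi m y v (n v) - (1 - y v))
      = ∑ v, if n v = v then 0 else slack m y z v (n v) - 2 * z v (n v) := by
  have hre : ∑ v, (psi m y v (n v) - (1 - y v))
      = ∑ v, (psi m y (n v) v - (1 - y (n v))) := by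
    have hinv : Function.Involutive n := hn
    rw [← Equiv.sum_comp hinv.toPerm]
    exact Finset.sum_congr rfl fun v _ => by simp [hn]
  rw [two_mul]
  nth_rewrite 2 [hre]
  rw [← Finset.sum_add_distrib]
  refine Finset.sum_congr rfl fun v _ => ?_
  have hiff : v = m (n v) ↔ n v = m v := ⟨fun h => by rw [h, hm, ← h], fun h => by rw [h, hm]⟩
  by_cases h : n v = v
  · simp [psi, h]
  · simp only [psi, slack, h, Ne.symm h, if_false, hiff]
    split_ifs <;> ring

variable {Δ : ℕ} {R : ℕ → Setoid V}

open Classical in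
theorem two_mul_gap (hm : ∀ v, m (m v) = v) (hn : ∀ v, n (n v) = v)
    (hz : ∀ u w, z u w = ∑ s ∈ Finset.range Δ, if (R s).r u w then 1 else 0)
    (htight : ∀ v, m v ≠ v → slack m y z v (m v) = 0) :
    2 * gap m y n = (∑ v, if n v = v then 0 else slack m y z v (n v))
      + 2 * ∑ s ∈ Finset.range Δ,
        (((innerMatched (R s).r m).card : ℤ) - (innerMatched (R s).r n).card) := by
  have hzsum : ∀ k : V → V, (∑ v, if k v = v then 0 else z v (k v))
      = ∑ s ∈ Finset.range Δ, ((innerMatched (R s).r k).card : ℤ) := by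
    intro k
    have : ∀ s, ((innerMatched (R s).r k).card : ℤ)
        = ∑ v, if k v = v then 0 else if (R s).r v (k v) then 1 else 0 := by
      intro s
      rw [innerMatched, Finset.card_filter]
      push_cast
      refine Finset.sum_congr rfl fun v _ => ?_
      by_cases h : k v = v <;> simp [IsDeficit, h]
    simp only [this]
    rw [Finset.sum_comm]
    refine Finset.sum_congr rfl fun v _ => ?_
    by_cases h : k v = v <;> simp [h, hz]
  have hgap : gap m y n = ∑ v, (psi m y v (n v) - (1 - y v))
      - ∑ v, (psi m y v (m v) - (1 - y v)) := by
    rw [gap, ← Finset.sum_sub_distrib]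
    exact Finset.sum_congr rfl fun v _ => by ring
  have hsp : ∀ k : V → V, (∑ v, if k v = v then 0 else slack m y z v (k v) - 2 * z v (k v))
      = (∑ v, if k v = v then 0 else slack m y z v (k v))
        - 2 * ∑ v, if k v = v then 0 else z v (k v) := by
    intro k
    rw [Finset.mul_sum, ← Finset.sum_sub_distrib]
    refine Finset.sum_congr rfl fun v _ => ?_
    split_ifs <;> ring
  have hm0 : (∑ v, if m v = v then 0 else slack m y z v (m v)) = 0 :=
    Finset.sum_eq_zero fun v _ => by
      by_cases h : m v = v
      · simp [h]
      · simp [h, htight v h]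
  rw [hgap, mul_sub, two_mul_sum_psi (z := z) hm hn, two_mul_sum_psi (z := z) hm hm, hsp, hsp,
    hm0, hzsum, hzsum, Finset.sum_sub_distrib]
  ring

/-- Weak duality and complementary slackness: the gap of a matching is nonnegative, and if it is
zero then all edges of the matching are tight, and the matching is as large as possible within
every class that carries a positive dual. -/
theorem weak_duality (hm : ∀ v, m (m v) = v) (hn : IsMate G n)
    (hz : ∀ u w, z u w = ∑ s ∈ Finset.range Δ, open Classical in if (R s).r u w then 1 else 0)
    (htight : ∀ v, m v ≠ v → slack m y z v (m v) = 0)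
    (hslack : ∀ u w, G.Adj u w → 0 ≤ slack m y z u w)
    (hU : ∀ s < Δ, AtMostOneDeficit (R s).r m) :
    0 ≤ gap m y n ∧ (gap m y n = 0 → (∀ v, n v ≠ v → slack m y z v (n v) = 0) ∧
      ∀ s < Δ, AtMostOneDeficit (R s).r n) := by
  classical
  have key := two_mul_gap (y := y) (n := n) hm hn.invol hz htight
  have h1 : ∀ v ∈ Finset.univ, 0 ≤ if n v = v then 0 else slack m y z v (n v) := by
    intro v _
    split_ifs with h
    · rfl
    · exact hslack _ _ (hn.adj v h)
  have h2 : ∀ s ∈ Finset.range Δ,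
      0 ≤ ((innerMatched (R s).r m).card : ℤ) - (innerMatched (R s).r n).card := by
    intro s hs
    have := (card_innerMatched_le (R s) hm hn.invol (hU s (Finset.mem_range.1 hs))).1
    omega
  have h3 := Finset.sum_nonneg h1
  have h4 := Finset.sum_nonneg h2
  refine ⟨by linarith, fun h0 => ⟨fun v hv => ?_, fun s hs => ?_⟩⟩
  · have := (Finset.sum_eq_zero_iff_of_nonneg h1).1 (by linarith) v (Finset.mem_univ _)
    simpa [hv] using this
  · have := (Finset.sum_eq_zero_iff_of_nonneg h2).1 (by linarith) s (Finset.mem_range.2 hs)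
    exact (card_innerMatched_le (R s) hm hn.invol (hU s hs)).2 (by omega)

end Duality

/-! ### Outer vertices, stability and blossoms -/

section Outer

variable {V : Type*} [Fintype V] [DecidableEq V]

/-- Vertex duals `y`, and for every pair of vertices half the sum `z` of the duals of the blossoms
that contain both of them. -/
structure Dual (V : Type*) where
  y : V → ℤ
  z : V → V → ℤ

/-- `x` is outer: some matching of zero gap and of the same size as `m` misses `x`. -/
def Outer (G : SimpleGraph V) (m : V → V) (D : Dual V) (x : V) : Prop :=
  ∃ n, IsMate G n ∧ gap m D.y n = 0 ∧ fixCard n = fixCard m ∧ n x = x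

/-- The edge `uw` has slack zero. -/
def Tight (G : SimpleGraph V) (m : V → V) (D : Dual V) (u w : V) : Prop :=
  G.Adj u w ∧ slack m D.y D.z u w = 0

/-- The blossoms: connected components of the graph of tight edges between outer vertices. Every
other vertex is a class by itself. -/
def blossom (G : SimpleGraph V) (m : V → V) (D : Dual V) : Setoid V :=
  Relation.EqvGen.setoid fun u w => Outer G m D u ∧ Outer G m D w ∧ Tight G m D u w

/-- The dual solution `D` is feasible and proves that `m` has maximum size among all matchings of
zero gap. -/
structure IsOptimal (G : SimpleGraph V) (m : V → V) (D : Dual V) : Prop where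
  mate : IsMate G m
  gap_nonneg : ∀ n, IsMate G n → 0 ≤ gap m D.y n
  slack_eq_zero : ∀ n, IsMate G n → gap m D.y n = 0 → ∀ v, n v ≠ v →
    slack m D.y D.z v (n v) = 0
  z_eq_zero : ∀ a c, a ≠ c → ¬ Outer G m D a → D.z a c = 0
  z_nonneg : ∀ a c, 0 ≤ D.z a c
  z_symm : ∀ a c, D.z a c = D.z c a
  le_fixCard : ∀ n, IsMate G n → gap m D.y n = 0 → fixCard m ≤ fixCard n

/-- A matching of zero gap that misses all vertices of `A`. -/
structure IsTightAvoiding (G : SimpleGraph V) (m : V → V) (D : Dual V) (A : Finset V)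
    (n : V → V) : Prop where
  mate : IsMate G n
  gap_eq : gap m D.y n = 0
  avoid : ∀ a ∈ A, n a = a

variable {G : SimpleGraph V} {m n : V → V} {D : Dual V} {A : Finset V}

theorem outer_of_fixed (hm : IsMate G m) {f : V} (hf : m f = f) : Outer G m D f :=
  ⟨m, hm, gap_self, rfl, hf⟩

theorem outer_of_blossom {u w : V} (h : (blossom G m D).r u w) (hne : u ≠ w) :
    Outer G m D u ∧ Outer G m D w := by
  have : u = w ∨ (Outer G m D u ∧ Outer G m D w) := by
    clear hne
    induction h with
    | rel _ _ h => exact .inr ⟨h.1, h.2.1⟩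
    | refl => exact .inl rfl
    | symm _ _ _ ih =>
      rcases ih with h | h
      · exact .inl h.symm
      · exact .inr h.symm
    | trans _ _ _ _ _ ih1 ih2 =>
      rcases ih1 with rfl | h
      · exact ih2
      · rcases ih2 with rfl | h'
        · exact .inr h
        · exact .inr ⟨h.1, h'.2⟩
  exact this.resolve_left hne

namespace IsOptimal

theorem slack_comm (h : IsOptimal G m D) (u w : V) :
    slack m D.y D.z u w = slack m D.y D.z w u := by
  have hiff : u = m w ↔ w = m u :=
    ⟨fun e => by rw [e, h.mate.invol], fun e => by rw [e, h.mate.invol]⟩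
  simp only [slack, h.z_symm u w, hiff]; ring

theorem tight_comm (h : IsOptimal G m D) {u w : V} (ht : Tight G m D u w) : Tight G m D w u :=
  ⟨ht.1.symm, by rw [h.slack_comm]; exact ht.2⟩

theorem tight_mate (h : IsOptimal G m D) {v : V} (hv : m v ≠ v) : Tight G m D v (m v) :=
  ⟨h.mate.adj v hv, h.slack_eq_zero m h.mate gap_self v hv⟩

theorem removeEdge (h : IsOptimal G m D) (hn : IsTightAvoiding G m D A n) {a : V}
    (ha : n a ≠ a) (hout : ¬ Outer G m D a) :
    IsTightAvoiding G m D (Insert.insert a A) (removeEdge n a) := by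
  refine ⟨hn.mate.removeEdge a, ?_, fun b hb => ?_⟩
  · have h1 := h.slack_eq_zero n hn.mate hn.gap_eq a ha
    have h2 := h.z_eq_zero a (n a) ha.symm hout
    rw [gap_removeEdge h.mate.invol hn.mate.invol ha, hn.gap_eq]
    simp only [slack, h2] at h1
    linarith
  · rw [removeEdge_eq_self_iff]
    rcases Finset.mem_insert.1 hb with rfl | hb
    · tauto
    · exact .inl (hn.avoid b hb)

theorem addEdge (h : IsOptimal G m D) (hn : IsTightAvoiding G m D A n) {a b : V}
    (ha : n a = a) (hb : n b = b) (hab : Tight G m D a b) (haA : a ∉ A) (hbA : b ∉ A) :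
    IsTightAvoiding G m D A (addEdge n a b) := by
  have hmate := hn.mate.addEdge ha hb hab.1
  refine ⟨hmate, le_antisymm ?_ (h.gap_nonneg _ hmate), fun c hc => ?_⟩
  · rw [gap_addEdge h.mate.invol ha hb hab.1.ne, hn.gap_eq]
    have h1 := hab.2
    have h2 := h.z_nonneg a b
    simp only [slack] at h1
    linarith
  · rw [addEdge_eq_self_iff hab.1.ne]
    exact ⟨hn.avoid c hc, fun e => haA (e ▸ hc), fun e => hbA (e ▸ hc)⟩

/-- Exchange property of the matchings of zero gap that miss a given set, when the second one has
maximum size among them. -/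
theorem exchange (h : IsOptimal G m D) {c : ℕ}
    (hmin : ∀ k, IsTightAvoiding G m D A k → c ≤ fixCard k) {n₁ n₂ : V → V}
    (h₁ : IsTightAvoiding G m D A n₁) (h₂ : IsTightAvoiding G m D A n₂) (hc : fixCard n₂ = c)
    {x : V} (hx : n₂ x = x) (hx' : n₁ x ≠ x) :
    ∃ e n₁' n₂', n₁ e = e ∧ n₂ e ≠ e ∧
      IsTightAvoiding G m D A n₁' ∧ IsTightAvoiding G m D A n₂' ∧
      fixCard n₁' = fixCard n₁ ∧ fixCard n₂' = c ∧
      (∀ v, n₁' v = v ↔ v = x ∨ (n₁ v = v ∧ v ≠ e)) ∧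
      ∀ v, n₂' v = v ↔ v = e ∨ (n₂ v = v ∧ v ≠ x) := by
  obtain ⟨n₁', n₂', hm₁, hm₂, hpt, halt⟩ := AltPath.exchange h₁.mate h₂.mate hx hx'
  have hsum := gap_add_gap (m := m) (y := D.y) hpt
  rw [h₁.gap_eq, h₂.gap_eq] at hsum
  have hg₁ := h.gap_nonneg _ hm₁
  have hg₂ := h.gap_nonneg _ hm₂
  have ht₁ : IsTightAvoiding G m D A n₁' := ⟨hm₁, by linarith, fun a ha => by
    rcases hpt a with ⟨h, -⟩ | ⟨h, -⟩
    · rw [h, h₁.avoid a ha]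
    · rw [h, h₂.avoid a ha]⟩
  have ht₂ : IsTightAvoiding G m D A n₂' := ⟨hm₂, by linarith, fun a ha => by
    rcases hpt a with ⟨-, h⟩ | ⟨-, h⟩
    · rw [h, h₂.avoid a ha]
    · rw [h, h₁.avoid a ha]⟩
  rcases halt with ⟨e, he, he', hf₁, hf₂⟩ | ⟨a, ℓ, -, -, -, -, -, hf⟩
  · exact ⟨e, n₁', n₂', he, he', ht₁, ht₂, fixCard_exchange he hx' hf₁,
      (fixCard_exchange hx he' hf₂).trans hc, hf₁, hf₂⟩
  · exfalso
    have hlt : fixCard n₂' < fixCard n₂ := by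
      refine Finset.card_lt_card ⟨fun v hv => ?_, fun hsub => ?_⟩
      · simp only [Finset.mem_filter, Finset.mem_univ, true_and] at hv ⊢
        exact ((hf v).1 hv).1
      · have : x ∈ Finset.univ.filter fun v => n₂' v = v := hsub (by simp [hx])
        simp only [Finset.mem_filter, Finset.mem_univ, true_and] at this
        exact ((hf x).1 this).2.1 rfl
    have := hmin _ ht₂
    omega

/-- Stability. Deleting a set `A` of vertices that are not outer but have tight edges to outer
vertices costs exactly one matching edge per deleted vertex, and does not change which vertices are
outer. -/
theorem stability (h : IsOptimal G m D) (A : Finset V)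
    (hA : ∀ a ∈ A, ¬ Outer G m D a ∧ ∃ b, Outer G m D b ∧ Tight G m D b a) :
    (∀ n, IsTightAvoiding G m D A n → fixCard m + 2 * A.card ≤ fixCard n) ∧
      (∀ n, IsTightAvoiding G m D A n → fixCard n = fixCard m + 2 * A.card →
        ∀ z, n z = z → z ∉ A → Outer G m D z) ∧
      ∀ z, Outer G m D z →
        ∃ n, IsTightAvoiding G m D A n ∧ fixCard n = fixCard m + 2 * A.card ∧ n z = z := by
  induction A using Finset.induction_on with
  | empty =>
    refine ⟨fun n hn => ?_, fun n hn hc z hz _ => ⟨n, hn.mate, hn.gap_eq, by simpa using hc, hz⟩,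
      ?_⟩
    · simpa using h.le_fixCard n hn.mate hn.gap_eq
    · rintro z ⟨n, hn, hg, hc, hz⟩
      exact ⟨n, ⟨hn, hg, by simp⟩, by simpa using hc, hz⟩
  | insert a A haA ih =>
    obtain ⟨h1, h2, h3⟩ := ih fun b hb => hA b (Finset.mem_insert_of_mem hb)
    obtain ⟨haout, b, hb, hba⟩ := hA a (Finset.mem_insert_self a A)
    have hAout : ∀ c ∈ A, ¬ Outer G m D c := fun c hc => (hA c (Finset.mem_insert_of_mem hc)).1
    have hbA : b ∉ A := fun hc => hAout b hc hb
    have hcard : (Insert.insert a A).card = A.card + 1 := Finset.card_insert_of_notMem haA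
    have hsub : ∀ n, IsTightAvoiding G m D (Insert.insert a A) n → IsTightAvoiding G m D A n :=
      fun n hn => ⟨hn.mate, hn.gap_eq, fun c hc => hn.avoid c (Finset.mem_insert_of_mem hc)⟩
    refine ⟨fun n hn => ?_, fun n hn hc z hz hzA => ?_, fun z hz => ?_⟩
    · have hle := h1 n (hsub n hn)
      have hne : fixCard n ≠ fixCard m + 2 * A.card := fun e =>
        haout (h2 n (hsub n hn) e a (hn.avoid a (Finset.mem_insert_self a A)) haA)
      obtain ⟨i, hi⟩ := even_fixCard_add hn.mate.invol
      obtain ⟨j, hj⟩ := even_fixCard_add h.mate.invol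
      omega
    · rw [hcard] at hc
      rw [Finset.mem_insert, not_or] at hzA
      by_cases hzb : z = b
      · rwa [hzb]
      -- If `n` also misses `b`, the tight edge `ab` can be added to it.
      have hadd : ∀ k, IsTightAvoiding G m D A k → fixCard k = fixCard n → k a = a → k b = b →
          k z = z → Outer G m D z := by
        intro k hk hkc hka hkb hkz
        have ht := h.addEdge hk hkb hka hba hbA haA
        have hcc := fixCard_addEdge hkb hka hba.1.ne
        exact h2 _ ht (by omega) z ((addEdge_eq_self_iff hba.1.ne z).2 ⟨hkz, hzb, hzA.1⟩) hzA.2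
      have hna := hn.avoid a (Finset.mem_insert_self a A)
      by_cases hnb : n b = b
      · exact hadd n (hsub n hn) rfl hna hnb hz
      · obtain ⟨k, hk, hkc, hkb⟩ := h3 b hb
        obtain ⟨e, n₁, n₂, he, he', ht₁, ht₂, hc₁, hc₂, hf₁, hf₂⟩ :=
          h.exchange h1 (hsub n hn) hk hkc hkb hnb
        have hn₂e : n₂ e = e := (hf₂ e).2 (.inl rfl)
        have heA : e ∉ A := fun hc => he' (hk.avoid e hc)
        have heout : Outer G m D e := h2 n₂ ht₂ hc₂ e hn₂e heA
        by_cases hez : e = z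
        · rwa [← hez]
        have hea : e ≠ a := fun h' => haout (h' ▸ heout)
        exact hadd n₁ ht₁ hc₁ ((hf₁ a).2 (.inr ⟨hna, hea.symm⟩)) ((hf₁ b).2 (.inl rfl))
          ((hf₁ z).2 (.inr ⟨hz, Ne.symm hez⟩))
    · obtain ⟨n, hn, hc, hnz⟩ := h3 z hz
      have hna : n a ≠ a := fun e => haout (h2 n hn hc a e haA)
      refine ⟨_, h.removeEdge hn hna haout, ?_, (removeEdge_eq_self_iff a z).2 (.inl hnz)⟩
      rw [fixCard_removeEdge hn.mate hna, hc, hcard]; ring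

/-- A tight edge joins an outer vertex only to outer vertices and to mates of outer vertices. -/
theorem outer_mate_of_tight (h : IsOptimal G m D) {u w : V} (hu : Outer G m D u)
    (ht : Tight G m D u w) (hw : ¬ Outer G m D w) : Outer G m D (m w) := by
  have hmw : m w ≠ w := fun e => hw (outer_of_fixed h.mate e)
  have hm : IsTightAvoiding G m D ∅ m := ⟨h.mate, gap_self, by simp⟩
  have hs := (h.stability {w} (by simpa using ⟨hw, u, hu, ht⟩)).2.1 (AltPath.removeEdge m w)
    (h.removeEdge hm hmw hw) (by rw [fixCard_removeEdge h.mate hmw]; simp)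
  exact hs (m w) ((removeEdge_eq_self_iff w (m w)).2 (by simp)) (by simpa using hmw)

/-- Gallai's lemma: a matching of zero gap that misses the set `A` of `stability` and has maximum
size misses at most one vertex of each blossom. -/
theorem gallai (h : IsOptimal G m D) (A : Finset V)
    (hA : ∀ a ∈ A, ¬ Outer G m D a ∧ ∃ b, Outer G m D b ∧ Tight G m D b a) {x y : V}
    (hxy : (blossom G m D).r x y) (hne : x ≠ y) (hn : IsTightAvoiding G m D A n)
    (hc : fixCard n = fixCard m + 2 * A.card) (hx : n x = x) (hy : n y = y) : False := by
  obtain ⟨h1, -, h3⟩ := h.stability A hA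
  have hAout : ∀ c, Outer G m D c → c ∉ A := fun c hc hcA => (hA c hcA).1 hc
  have base : ∀ k, IsTightAvoiding G m D A k → fixCard k = fixCard m + 2 * A.card →
      ∀ u w, Outer G m D u → Outer G m D w → Tight G m D u w → k u = u → k w = w → False := by
    intro k hk hkc u w hu hw ht hku hkw
    have := h1 _ (h.addEdge hk hku hkw ht (hAout u hu) (hAout w hw))
    have := fixCard_addEdge hku hkw ht.1.ne
    omega
  have hsymm : Std.Symm fun u w => Outer G m D u ∧ Outer G m D w ∧ Tight G m D u w :=
    ⟨fun _ _ h' => ⟨h'.2.1, h'.1, h.tight_comm h'.2.2⟩⟩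
  have hgen : Relation.ReflTransGen
      (fun u w => Outer G m D u ∧ Outer G m D w ∧ Tight G m D u w) x y := by
    clear hx hy hne
    induction hxy with
    | rel _ _ h => exact .single h
    | refl => exact .refl
    | symm _ _ _ ih => exact symm ih
    | trans _ _ _ _ _ ih1 ih2 => exact ih1.trans ih2
  clear hxy
  induction hgen using Relation.ReflTransGen.head_induction_on generalizing n with
  | refl => exact hne rfl
  | @head x z hxz _ ih =>
    obtain ⟨hxo, hzo, ht⟩ := hxz
    by_cases hnz : n z = z
    · exact base n hn hc x z hxo hzo ht hx hnz
    have hzy : z ≠ y := fun e => hnz (e ▸ hy)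
    obtain ⟨k, hk, hkc, hkz⟩ := h3 z hzo
    by_cases hkx : k x = x
    · exact base k hk hkc x z hxo hzo ht hkx hkz
    obtain ⟨e, n₁, n₂, he, he', ht₁, ht₂, hc₁, hc₂, hf₁, hf₂⟩ := h.exchange h1 hk hn hc hx hkx
    by_cases hez : e = z
    · exact ih hzy ht₂ hc₂ ((hf₂ z).2 (.inl hez.symm)) ((hf₂ y).2 (.inr ⟨hy, hne.symm⟩))
    · exact base n₁ ht₁ (hc₁.trans hkc) x z hxo hzo ht ((hf₁ x).2 (.inl rfl))
        ((hf₁ z).2 (.inr ⟨hkz, Ne.symm hez⟩))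

/-- `m` without its edges at `A` has zero gap if no vertex of `A` is outer. -/
theorem exists_removeEdges (h : IsOptimal G m D) (A : Finset V)
    (hA : ∀ a ∈ A, ¬ Outer G m D a ∧ m a ∉ A) :
    ∃ n, IsTightAvoiding G m D A n ∧ fixCard n = fixCard m + 2 * A.card ∧
      ∀ v, n v = if v ∈ A ∨ m v ∈ A then v else m v := by
  induction A using Finset.induction_on with
  | empty => exact ⟨m, ⟨h.mate, gap_self, by simp⟩, by simp, by simp⟩
  | insert a A haA ih =>
    obtain ⟨n, hn, hc, hf⟩ := ih fun b hb =>
      ⟨(hA b (Finset.mem_insert_of_mem hb)).1,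
        fun hc => (hA b (Finset.mem_insert_of_mem hb)).2 (Finset.mem_insert_of_mem hc)⟩
    obtain ⟨haout, hma⟩ := hA a (Finset.mem_insert_self a A)
    rw [Finset.mem_insert, not_or] at hma
    have hna : n a = m a := by rw [hf, if_neg (by tauto)]
    have hna' : n a ≠ a := by rw [hna]; exact hma.1
    refine ⟨_, h.removeEdge hn hna' haout, ?_, fun v => ?_⟩
    · rw [fixCard_removeEdge hn.mate hna', hc, Finset.card_insert_of_notMem haA]; ring
    · have hiff : v = m a ↔ m v = a :=
        ⟨fun e => by rw [e, h.mate.invol], fun e => by rw [← e, h.mate.invol]⟩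
      simp only [AltPath.removeEdge, hna, hf v, Finset.mem_insert, hiff]
      by_cases h1 : v = a <;> by_cases h2 : m v = a <;> simp [h1, h2]

/-- Every blossom contains at most one vertex that is not matched within it. -/
theorem atMostOneDeficit (h : IsOptimal G m D) : AtMostOneDeficit (blossom G m D).r m := by
  classical
  intro x y hxy hx hy
  by_contra hne
  obtain ⟨hxo, hyo⟩ := outer_of_blossom hxy hne
  -- Delete all inner vertices. This turns the deficits into missed vertices.
  set A := Finset.univ.filter fun a => ¬ Outer G m D a ∧ Outer G m D (m a) with hAdef
  obtain ⟨n, hn, hc, hf⟩ := h.exists_removeEdges A fun a ha => by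
    simp only [hAdef, Finset.mem_filter, Finset.mem_univ, true_and] at ha ⊢
    exact ⟨ha.1, fun h' => h'.1 ha.2⟩
  have hdef : ∀ v, Outer G m D v → IsDeficit (blossom G m D).r m v → n v = v := by
    intro v hv hd
    rw [hf]
    split_ifs with h'
    · rfl
    rcases hd with hd | hd
    · exact hd
    · exfalso
      have hmv : m v ≠ v := fun e => hd (by rw [e])
      refine h' (.inr ?_)
      simp only [hAdef, Finset.mem_filter, Finset.mem_univ, true_and, h.mate.invol]
      exact ⟨fun ho => hd (Relation.EqvGen.rel _ _ ⟨hv, ho, h.tight_mate hmv⟩), hv⟩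
  refine h.gallai A (fun a ha => ?_) hxy hne hn hc (hdef x hxo hx) (hdef y hyo hy)
  simp only [hAdef, Finset.mem_filter, Finset.mem_univ, true_and] at ha
  refine ⟨ha.1, m a, ha.2, h.tight_comm (h.tight_mate fun e => ha.1 ?_)⟩
  rw [← e]; exact ha.2

end IsOptimal

end Outer

/-! ### The dual solutions of the search -/

section Search

variable {V : Type*} [Fintype V] [DecidableEq V] {G : SimpleGraph V} {m n : V → V} {y : V → ℤ}

/-- `a 0, …, a ℓ` is an alternating path whose edges of odd index are the matching edges. -/
structure IsAltSeq (G : SimpleGraph V) (m : V → V) (a : ℕ → V) (ℓ : ℕ) : Prop where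
  inj : ∀ i ≤ ℓ, ∀ j ≤ ℓ, a i = a j → i = j
  adj : ∀ i < ℓ, G.Adj (a i) (a (i + 1))
  odd : ∀ i < ℓ, Odd i → m (a i) = a (i + 1)
  even : ∀ i < ℓ, Even i → m (a i) ≠ a (i + 1)

/-- Every augmenting path has length at least `2 * Δ`. -/
def NoShortAugmentation (G : SimpleGraph V) (m : V → V) (Δ : ℕ) : Prop :=
  ∀ a ℓ, IsAltSeq G m a ℓ → Odd ℓ → m (a 0) = a 0 → m (a ℓ) = a ℓ → 2 * Δ ≤ ℓ

omit [Fintype V] [DecidableEq V] in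
theorem IsZigzag.isAltSeq {a : ℕ → V} {ℓ : ℕ} (h : IsZigzag n m a ℓ) (hn : IsMate G n)
    (hm : IsMate G m) (h0 : m (a 0) = a 0) : IsAltSeq G m a ℓ where
  inj := h.inj
  adj i hi := by
    rcases Nat.even_or_odd i with he | ho
    · have := hn.adj (a i)
      rw [h.even i hi he] at this
      exact this fun e => absurd (h.inj _ (by omega) _ (by omega) e) (by omega)
    · have := hm.adj (a i)
      rw [h.odd i hi ho] at this
      exact this fun e => absurd (h.inj _ (by omega) _ (by omega) e) (by omega)
  odd := h.odd
  even i hi he e := h.fst_ne_snd hn.invol hm.invol h0 hi (by rw [h.even i hi he, e])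

/-- The number of vertices that `n` covers by edges outside `m`. -/
def cost (m n : V → V) : ℕ := (Finset.univ.filter fun v => n v ≠ v ∧ n v ≠ m v).card

theorem even_cost (hm : ∀ v, m (m v) = v) (hn : ∀ v, n (n v) = v) : Even (cost m n) := by
  refine even_card_of_fixedPointFree_involution hn (fun v hv => ?_) (fun v hv => ?_)
  · simp only [Finset.mem_filter, Finset.mem_univ, true_and, hn] at hv ⊢
    exact ⟨fun e => hv.1 e.symm, fun e => hv.2 (by rw [← hm (n v), ← e])⟩
  · simp only [Finset.mem_filter, Finset.mem_univ, true_and] at hv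
    exact hv.1

theorem gap_eq : gap m y n = cost m n + (∑ v, if n v = v then 1 - y v else 0)
    - ∑ v, if m v = v then 1 - y v else 0 := by
  rw [gap, cost, Finset.card_filter, Finset.sum_sub_distrib]
  push_cast
  rw [← Finset.sum_add_distrib]
  congr 1
  · refine Finset.sum_congr rfl fun v _ => ?_
    by_cases h : n v = v <;> by_cases h' : n v = m v <;> simp_all [psi]
  · exact Finset.sum_congr rfl fun v _ => by simp [psi]

/-- The gap of a matching that misses the same vertices as `m`, except for `x` in place of `e`. -/
theorem gap_eq_of_exchange {e x : V} (he : m e = e) (hx : m x ≠ x)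
    (hf : ∀ v, n v = v ↔ v = x ∨ (m v = v ∧ v ≠ e)) :
    gap m y n = cost m n - y x + y e := by
  have hne : x ≠ e := fun h => hx (h ▸ he)
  rw [gap_eq, add_sub_assoc, ← Finset.sum_sub_distrib]
  rw [← Finset.sum_subset (Finset.subset_univ {x, e}), Finset.sum_pair hne]
  · simp [hf, he, hx, hne.symm]; ring
  · intro v _ hv
    simp only [Finset.mem_insert, Finset.mem_singleton, not_or] at hv
    simp [hf, hv.1, hv.2]

/-- The gap of a matching that covers all vertices that `m` covers, and also `x` and `g`. -/
theorem gap_eq_of_augment {x g : V} (hxg : x ≠ g) (hx : m x = x) (hg : m g = g)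
    (hf : ∀ v, n v = v ↔ m v = v ∧ v ≠ x ∧ v ≠ g) :
    gap m y n = cost m n - (1 - y x) - (1 - y g) := by
  rw [gap_eq, add_sub_assoc, ← Finset.sum_sub_distrib]
  rw [← Finset.sum_subset (Finset.subset_univ {x, g}), Finset.sum_pair hxg]
  · simp [hf, hx, hg]; ring
  · intro v _ hv
    simp only [Finset.mem_insert, Finset.mem_singleton, not_or] at hv
    simp [hf, hv.1, hv.2]

theorem IsZigzag.le_cost {n₁ n₂ : V → V} {a : ℕ → V} {ℓ : ℕ} (h : IsZigzag n₁ n₂ a ℓ)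
    (h₁ : ∀ v, n₁ (n₁ v) = v) (h₂ : ∀ v, n₂ (n₂ v) = v) (h0 : n₂ (a 0) = a 0)
    (hn : ∀ i < ℓ, n (a i) = n₁ (a i)) : ℓ ≤ cost n₂ n := by
  rw [cost, ← Finset.card_range ℓ]
  refine Finset.card_le_card_of_injOn a (fun i hi => ?_) fun i hi j hj hij => ?_
  · have hi' := Finset.mem_range.1 hi
    simp only [Finset.coe_filter, Finset.mem_univ, true_and, Set.mem_ofPred_eq, hn i hi']
    exact ⟨h.fst_ne h₁ hi'.le (by omega), h.fst_ne_snd h₁ h₂ h0 hi'⟩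
  · have hi' := Finset.mem_range.1 hi
    have hj' := Finset.mem_range.1 hj
    exact h.inj i hi'.le j hj'.le hij

theorem IsZigzag.succ_le_cost {n₁ n₂ : V → V} {a : ℕ → V} {ℓ : ℕ} (h : IsZigzag n₁ n₂ a ℓ)
    (h₁ : ∀ v, n₁ (n₁ v) = v) (h₂ : ∀ v, n₂ (n₂ v) = v) (h0 : n₂ (a 0) = a 0)
    (hℓ : Odd ℓ) (hend : n₂ (a ℓ) = a ℓ) (hn : ∀ i ≤ ℓ, n (a i) = n₁ (a i)) :
    ℓ + 1 ≤ cost n₂ n := by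
  rw [cost, ← Finset.card_range (ℓ + 1)]
  refine Finset.card_le_card_of_injOn a (fun i hi => ?_) fun i hi j hj hij => ?_
  · have hi' : i ≤ ℓ := Nat.lt_succ_iff.1 (Finset.mem_range.1 hi)
    simp only [Finset.coe_filter, Finset.mem_univ, true_and, Set.mem_ofPred_eq, hn i hi']
    have hne := h.fst_ne h₁ hi' (fun e => e ▸ hℓ)
    refine ⟨hne, ?_⟩
    rcases hi'.lt_or_eq with hlt | rfl
    · exact h.fst_ne_snd h₁ h₂ h0 hlt
    · rwa [hend]
  · exact h.inj i (Nat.lt_succ_iff.1 (Finset.mem_range.1 hi)) j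
      (Nat.lt_succ_iff.1 (Finset.mem_range.1 hj)) hij

open Classical in
/-- One dual adjustment: the duals of outer vertices decrease, those of inner vertices (mates of
outer vertices that are not outer themselves) increase, and those of blossoms increase. -/
noncomputable def Dual.next (G : SimpleGraph V) (m : V → V) (D : Dual V) : Dual V where
  y x := D.y x + if Outer G m D x then -1 else if Outer G m D (m x) then 1 else 0
  z u w := D.z u w + if (blossom G m D).r u w then 1 else 0

/-- The dual solution after `Δ` dual adjustments. -/
noncomputable def dual (G : SimpleGraph V) (m : V → V) : ℕ → Dual V
  | 0 => ⟨fun _ => 1, fun _ _ => 0⟩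
  | Δ + 1 => (dual G m Δ).next G m

open Classical in
theorem dual_z_eq_sum (Δ : ℕ) (u w : V) : (dual G m Δ).z u w =
    ∑ s ∈ Finset.range Δ, if (blossom G m (dual G m s)).r u w then 1 else 0 := by
  induction Δ with
  | zero => simp [dual]
  | succ Δ ih => rw [Finset.sum_range_succ, ← ih]; rfl

theorem dual_z_nonneg (Δ : ℕ) (u w : V) : 0 ≤ (dual G m Δ).z u w := by
  classical
  rw [dual_z_eq_sum]
  exact Finset.sum_nonneg fun s _ => by split_ifs <;> simp

theorem dual_z_symm (Δ : ℕ) (u w : V) : (dual G m Δ).z u w = (dual G m Δ).z w u := by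
  classical
  simp only [dual_z_eq_sum]
  refine Finset.sum_congr rfl fun s _ => ?_
  have : (blossom G m (dual G m s)).r u w ↔ (blossom G m (dual G m s)).r w u :=
    ⟨fun h => Setoid.symm' _ h, fun h => Setoid.symm' _ h⟩
  simp only [this]

theorem exists_blossom_of_dual_z_pos {Δ : ℕ} {u w : V} (h : 0 < (dual G m Δ).z u w) :
    ∃ s < Δ, (blossom G m (dual G m s)).r u w := by
  classical
  by_contra hc
  push Not at hc
  rw [dual_z_eq_sum, Finset.sum_eq_zero] at h
  · exact lt_irrefl _ h
  · intro s hs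
    rw [if_neg (hc s (Finset.mem_range.1 hs))]

theorem dual_y_of_fixed (hm : IsMate G m) {f : V} (hf : m f = f) (Δ : ℕ) :
    (dual G m Δ).y f = 1 - Δ := by
  induction Δ with
  | zero => simp [dual]
  | succ Δ ih =>
    have : Outer G m (dual G m Δ) f := outer_of_fixed hm hf
    simp only [dual, Dual.next, this, if_true, ih]
    push_cast; ring

theorem outer_succ (hm : IsMate G m) {Δ : ℕ} {x : V} (h : Outer G m (dual G m Δ) x) :
    Outer G m (dual G m (Δ + 1)) x := by
  obtain ⟨n, hn, hg, hc, hx⟩ := h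
  refine ⟨n, hn, ?_, hc, hx⟩
  have hstep : ∀ v, Outer G m (dual G m Δ) v →
      1 - (dual G m (Δ + 1)).y v = (1 - (dual G m Δ).y v) + 1 := by
    intro v hv
    simp only [dual, Dual.next, hv, if_true]; ring
  have hsum : ∀ k : V → V, (∀ v, k v = v → Outer G m (dual G m Δ) v) →
      (∑ v, if k v = v then 1 - (dual G m (Δ + 1)).y v else 0)
        = (∑ v, if k v = v then 1 - (dual G m Δ).y v else 0) + fixCard k := by
    intro k hk
    rw [fixCard, Finset.card_filter]
    push_cast
    rw [← Finset.sum_add_distrib]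
    refine Finset.sum_congr rfl fun v _ => ?_
    by_cases h : k v = v
    · simp [h, hstep v (hk v h)]
    · simp [h]
  rw [gap_eq] at hg ⊢
  rw [hsum n fun v hv => ⟨n, hn, by rw [gap_eq, hg], hc, hv⟩,
    hsum m fun v hv => outer_of_fixed hm hv, hc]
  linarith

theorem outer_mono (hm : IsMate G m) {s Δ : ℕ} (h : s ≤ Δ) {x : V}
    (hx : Outer G m (dual G m s) x) : Outer G m (dual G m Δ) x := by
  induction h with
  | refl => exact hx
  | step _ ih => exact outer_succ hm ih

theorem dual_z_eq_zero (hm : IsMate G m) {Δ : ℕ} {a c : V} (hne : a ≠ c)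
    (ha : ¬ Outer G m (dual G m Δ) a) : (dual G m Δ).z a c = 0 := by
  refine le_antisymm ?_ (dual_z_nonneg Δ a c)
  by_contra hpos
  obtain ⟨s, hs, hr⟩ := exists_blossom_of_dual_z_pos (not_le.1 hpos)
  exact ha (outer_mono hm hs.le (outer_of_blossom hr hne).1)

/-- Feasibility of a dual solution: no slack is negative, and the edges of `m` are tight. -/
structure IsFeasible (G : SimpleGraph V) (m : V → V) (D : Dual V) : Prop where
  slack_mate : ∀ v, m v ≠ v → slack m D.y D.z v (m v) = 0
  slack_nonneg : ∀ u w, G.Adj u w → 0 ≤ slack m D.y D.z u w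

variable {Δ : ℕ}

theorem dual_weak_duality (hm : IsMate G m) (hF : IsFeasible G m (dual G m Δ))
    (hU : ∀ s < Δ, AtMostOneDeficit (blossom G m (dual G m s)).r m) (hn : IsMate G n) :
    0 ≤ gap m (dual G m Δ).y n ∧ (gap m (dual G m Δ).y n = 0 →
      (∀ v, n v ≠ v → slack m (dual G m Δ).y (dual G m Δ).z v (n v) = 0) ∧
      ∀ s < Δ, AtMostOneDeficit (blossom G m (dual G m s)).r n) :=
  weak_duality hm.invol hn (dual_z_eq_sum Δ) hF.slack_mate hF.slack_nonneg hU

/-- If a matching of zero gap were larger than `m`, some augmenting path would be too short. -/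
theorem fixCard_le_of_noShortAugmentation (hm : IsMate G m) (hF : IsFeasible G m (dual G m Δ))
    (hU : ∀ s < Δ, AtMostOneDeficit (blossom G m (dual G m s)).r m)
    (hL : NoShortAugmentation G m Δ) (hn : IsMate G n) (hg : gap m (dual G m Δ).y n = 0) :
    fixCard m ≤ fixCard n := by
  induction hk : (Finset.univ.filter fun v => n v ≠ m v).card using Nat.strong_induction_on
    generalizing n with
  | _ k ih =>
    by_contra hlt
    obtain ⟨f, hf, hf'⟩ : ∃ f, m f = f ∧ n f ≠ f := by
      by_contra hcon
      push Not at hcon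
      exact hlt (fixCard_le_of_imp hcon)
    obtain ⟨n₁, n₂, hm₁, hm₂, hpt, halt⟩ := exchange hn hm hf hf'
    have hsum := gap_add_gap (m := m) (y := (dual G m Δ).y) hpt
    rw [hg, gap_self] at hsum
    have hg₁ := (dual_weak_duality hm hF hU hm₁).1
    have hg₂ := (dual_weak_duality hm hF hU hm₂).1
    rcases halt with ⟨e, he, -, hf₁, -⟩ | ⟨a, ℓ, hz, hℓ, h0, hend, hna, hf₂⟩
    · have hc₁ : fixCard n₁ = fixCard n := fixCard_exchange he hf' hf₁
      refine absurd (ih _ ?_ hm₁ (by linarith) rfl) (by omega)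
      rw [← hk]
      refine Finset.card_lt_card ⟨fun v hv => ?_, fun hsub => ?_⟩
      · simp only [Finset.mem_filter, Finset.mem_univ, true_and] at hv ⊢
        rcases hpt v with ⟨h, -⟩ | ⟨h, -⟩
        · rwa [← h]
        · exact absurd h hv
      · have : f ∈ Finset.univ.filter fun v => n₁ v ≠ m v := hsub (by simpa [hf] using hf')
        simp only [Finset.mem_filter, Finset.mem_univ, true_and, hf] at this
        exact this ((hf₁ f).2 (.inl rfl))
    · have h00 : m (a 0) = a 0 := by rw [h0, hf]
      have hne : f ≠ a ℓ := fun h => by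
        have := hz.inj 0 (by omega) ℓ le_rfl (h0.trans h)
        subst this; simp at hℓ
      have hcost := hz.succ_le_cost hn.invol hm.invol h00 hℓ hend hna
      have hgap := gap_eq_of_augment (y := (dual G m Δ).y) hne hf hend hf₂
      rw [dual_y_of_fixed hm hf, dual_y_of_fixed hm hend] at hgap
      have hlong := hL a ℓ (hz.isAltSeq hn hm h00) hℓ h00 hend
      omega

theorem isOptimal_of_isFeasible (hm : IsMate G m) (hF : IsFeasible G m (dual G m Δ))
    (hU : ∀ s < Δ, AtMostOneDeficit (blossom G m (dual G m s)).r m)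
    (hL : NoShortAugmentation G m Δ) : IsOptimal G m (dual G m Δ) where
  mate := hm
  gap_nonneg _ hn := (dual_weak_duality hm hF hU hn).1
  slack_eq_zero _ hn hg := ((dual_weak_duality hm hF hU hn).2 hg).1
  z_eq_zero _ _ := dual_z_eq_zero hm
  z_nonneg := dual_z_nonneg Δ
  z_symm := dual_z_symm Δ
  le_fixCard _ := fixCard_le_of_noShortAugmentation hm hF hU hL

/-- An outer vertex covered by `m` is missed by a matching of zero gap that misses, besides it, only
vertices missed by `m`. -/
theorem IsOptimal.exists_exchange {D : Dual V} (h : IsOptimal G m D) {x : V}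
    (hx : Outer G m D x) (hmx : m x ≠ x) : ∃ e n, IsMate G n ∧ gap m D.y n = 0 ∧ m e = e ∧
      n e ≠ e ∧ ∀ v, n v = v ↔ v = x ∨ (m v = v ∧ v ≠ e) := by
  obtain ⟨k, hk, hg, hc, hkx⟩ := hx
  obtain ⟨e, n₁, -, he, -, ht, -, -, -, hf, -⟩ := h.exchange (A := ∅) (c := fixCard m)
    (fun n hn => h.le_fixCard n hn.mate hn.gap_eq) ⟨h.mate, gap_self, by simp⟩
    ⟨hk, hg, by simp⟩ hc hkx hmx
  refine ⟨e, n₁, ht.mate, ht.gap_eq, he, fun h' => ?_, hf⟩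
  rcases (hf e).1 h' with h' | h'
  · exact hmx (h' ▸ he)
  · exact h'.2 rfl

theorem IsOptimal.even_dual_y (h : IsOptimal G m (dual G m Δ)) {x : V}
    (hx : Outer G m (dual G m Δ) x) : Even ((dual G m Δ).y x + Δ - 1) := by
  by_cases hmx : m x = x
  · rw [dual_y_of_fixed h.mate hmx]; simp
  · obtain ⟨e, n, hn, hg, he, -, hf⟩ := h.exists_exchange hx hmx
    rw [gap_eq_of_exchange he hmx hf, dual_y_of_fixed h.mate he] at hg
    have hc := even_cost h.mate.invol hn.invol
    have : (dual G m Δ).y x + Δ - 1 = (cost m n : ℤ) := by linarith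
    rw [this]
    exact_mod_cast hc

theorem IsFeasible.next (hF : IsFeasible G m (dual G m Δ)) (h : IsOptimal G m (dual G m Δ)) :
    IsFeasible G m (dual G m (Δ + 1)) := by
  classical
  have hblossom : ∀ {u w}, Outer G m (dual G m Δ) u → Outer G m (dual G m Δ) w →
      Tight G m (dual G m Δ) u w → (blossom G m (dual G m Δ)).r u w :=
    fun hu hw ht => Relation.EqvGen.rel _ _ ⟨hu, hw, ht⟩
  have hslack : ∀ u w, slack m (dual G m (Δ + 1)).y (dual G m (Δ + 1)).z u w
      = slack m (dual G m Δ).y (dual G m Δ).z u w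
        + (if Outer G m (dual G m Δ) u then -1 else if Outer G m (dual G m Δ) (m u) then 1 else 0)
        + (if Outer G m (dual G m Δ) w then -1 else if Outer G m (dual G m Δ) (m w) then 1 else 0)
        + 2 * if (blossom G m (dual G m Δ)).r u w then 1 else 0 := by
    intro u w
    simp only [slack, dual, Dual.next]; ring
  constructor
  · intro v hv
    have ht := h.tight_mate hv
    rw [hslack, ht.2, h.mate.invol]
    by_cases h1 : Outer G m (dual G m Δ) v <;> by_cases h2 : Outer G m (dual G m Δ) (m v)
    · simp [h1, h2, hblossom h1 h2 ht]
    all_goals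
      have h3 : ¬ (blossom G m (dual G m Δ)).r v (m v) := fun h3 => by
        have := outer_of_blossom h3 hv.symm; tauto
      simp [h1, h2, h3]
  · intro u w huw
    have h0 := hF.slack_nonneg u w huw
    rw [hslack]
    by_cases h1 : Outer G m (dual G m Δ) u <;> by_cases h2 : Outer G m (dual G m Δ) w
    · by_cases h3 : (blossom G m (dual G m Δ)).r u w
      · simp [h1, h2, h3]; linarith
      · -- The slack of an edge between two outer vertices is even, so it is at least `2` here.
        have hpos : slack m (dual G m Δ).y (dual G m Δ).z u w ≠ 0 :=
          fun e => h3 (hblossom h1 h2 ⟨huw, e⟩)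
        obtain ⟨i, hi⟩ := h.even_dual_y h1
        obtain ⟨j, hj⟩ := h.even_dual_y h2
        have hev : ∃ k, slack m (dual G m Δ).y (dual G m Δ).z u w = 2 * k := by
          simp only [slack]
          split_ifs
          · exact ⟨i + j - Δ + 1 + (dual G m Δ).z u w - 1, by linarith⟩
          · exact ⟨i + j - Δ + 1 + (dual G m Δ).z u w, by linarith⟩
        obtain ⟨k, hk⟩ := hev
        simp only [h1, h2, h3, if_true, if_false]
        omega
    · have h4 : slack m (dual G m Δ).y (dual G m Δ).z u w = 0 → Outer G m (dual G m Δ) (m w) :=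
        fun e => h.outer_mate_of_tight h1 ⟨huw, e⟩ h2
      by_cases h5 : Outer G m (dual G m Δ) (m w)
      · simp only [h1, h2, h5, if_true, if_false]
        split_ifs <;> omega
      · have : slack m (dual G m Δ).y (dual G m Δ).z u w ≠ 0 := fun e => h5 (h4 e)
        simp only [h1, h2, h5, if_true, if_false]
        split_ifs <;> omega
    · have h4 : slack m (dual G m Δ).y (dual G m Δ).z u w = 0 → Outer G m (dual G m Δ) (m u) :=
        fun e => h.outer_mate_of_tight h2 (h.tight_comm ⟨huw, e⟩) h1
      by_cases h5 : Outer G m (dual G m Δ) (m u)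
      · simp only [h1, h2, h5, if_true, if_false]
        split_ifs <;> omega
      · have : slack m (dual G m Δ).y (dual G m Δ).z u w ≠ 0 := fun e => h5 (h4 e)
        simp only [h1, h2, h5, if_true, if_false]
        split_ifs <;> omega
    · simp only [h1, h2, if_false]
      split_ifs <;> omega

/-- As long as no augmenting path is too short, the search produces feasible dual solutions, and
every blossom has at most one deficit. -/
theorem dual_invariant (hm : IsMate G m) (hL : NoShortAugmentation G m Δ) :
    IsFeasible G m (dual G m Δ) ∧ ∀ s < Δ, AtMostOneDeficit (blossom G m (dual G m s)).r m := by
  induction Δ with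
  | zero =>
    refine ⟨⟨fun v _ => by simp [slack, dual], fun u w _ => ?_⟩, by simp⟩
    simp only [slack, dual]
    split_ifs <;> norm_num
  | succ Δ ih =>
    have hL' : NoShortAugmentation G m Δ := fun a ℓ h1 h2 h3 h4 => by
      have := hL a ℓ h1 h2 h3 h4
      omega
    obtain ⟨hF, hU⟩ := ih hL'
    have h := isOptimal_of_isFeasible hm hF hU hL'
    refine ⟨hF.next h, fun s hs => ?_⟩
    rcases (Nat.lt_succ_iff.1 hs).lt_or_eq with hs | rfl
    · exact hU s hs
    · exact h.atMostOneDeficit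

theorem isOptimal_dual (hm : IsMate G m) (hL : NoShortAugmentation G m Δ) :
    IsOptimal G m (dual G m Δ) :=
  isOptimal_of_isFeasible hm (dual_invariant hm hL).1 (dual_invariant hm hL).2 hL

end Search

/-! ### Matchings obtained from alternating paths -/

section PathMatching

variable {V : Type*} {G : SimpleGraph V} {m : V → V} {a : ℕ → V} {ℓ : ℕ}

namespace IsAltSeq

theorem odd_succ (h : IsAltSeq G m a ℓ) (hm : ∀ v, m (m v) = v) {i : ℕ} (hi : i < ℓ)
    (ho : Odd i) : m (a (i + 1)) = a i := by rw [← h.odd i hi ho, hm]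

theorem mate_mem (h : IsAltSeq G m a ℓ) (hm : ∀ v, m (m v) = v) (hℓ : Even ℓ) {i : ℕ}
    (hi : i ≤ ℓ) (h0 : i ≠ 0) : ∃ j ≤ ℓ, j ≠ 0 ∧ j ≠ i ∧ m (a i) = a j := by
  obtain ⟨k, rfl⟩ := Nat.exists_eq_succ_of_ne_zero h0
  rcases Nat.even_or_odd k with hk | hk
  · have hlt : k + 1 < ℓ := lt_of_le_of_ne hi fun e =>
      Nat.not_even_iff_odd.2 hk.add_one (e ▸ hℓ)
    exact ⟨k + 2, hlt, by omega, by omega, h.odd _ hlt hk.add_one⟩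
  · exact ⟨k, by omega, fun e => by simp [e] at hk, by omega, h.odd_succ hm hi hk⟩

theorem mate_ne (h : IsAltSeq G m a ℓ) (hm : ∀ v, m (m v) = v) (hℓ : Even ℓ) {i : ℕ}
    (hi : i ≤ ℓ) (h0 : i ≠ 0) : m (a i) ≠ a i := by
  obtain ⟨j, hj, -, hji, hmj⟩ := h.mate_mem hm hℓ hi h0
  exact fun e => hji (h.inj j hj i hi (hmj.symm.trans e))

theorem mate_start_ne (h : IsAltSeq G m a ℓ) (hm : ∀ v, m (m v) = v) (hℓ : Even ℓ) {i : ℕ}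
    (hi : i ≤ ℓ) (h0 : i ≠ 0) : m (a 0) ≠ a i := by
  intro e
  obtain ⟨j, hj, hj0, -, hmj⟩ := h.mate_mem hm hℓ hi h0
  rw [← e, hm] at hmj
  exact hj0 (h.inj j hj 0 (by omega) hmj.symm)

theorem take (h : IsAltSeq G m a ℓ) {k : ℕ} (hk : k ≤ ℓ) : IsAltSeq G m a k where
  inj i hi j hj := h.inj i (hi.trans hk) j (hj.trans hk)
  adj i hi := h.adj i (by omega)
  odd i hi := h.odd i (by omega)
  even i hi := h.even i (by omega)

theorem drop (h : IsAltSeq G m a ℓ) {k : ℕ} (hk : k ≤ ℓ) (hev : Even k) :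
    IsAltSeq G m (fun i => a (k + i)) (ℓ - k) where
  inj i hi j hj hij := by
    have := h.inj (k + i) (by omega) (k + j) (by omega) hij
    omega
  adj i hi := h.adj (k + i) (by omega)
  odd i hi ho := h.odd (k + i) (by omega) (hev.add_odd ho)
  even i hi he := h.even (k + i) (by omega) (hev.add he)

/-- An odd alternating path from a missed vertex to a covered vertex can be extended by the
matching edge at its end. -/
theorem extend (h : IsAltSeq G m a ℓ) (hm : IsMate G m) (hℓ : Odd ℓ) (h0 : m (a 0) = a 0)
    (hend : m (a ℓ) ≠ a ℓ) :
    IsAltSeq G m (fun i => if i ≤ ℓ then a i else m (a ℓ)) (ℓ + 1) := by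
  have hnew : ∀ i ≤ ℓ, a i ≠ m (a ℓ) := by
    intro i hi e
    have hmi : m (a i) = a ℓ := by rw [e, hm.invol]
    rcases Nat.eq_zero_or_pos i with rfl | hpos
    · rw [h0] at hmi
      have := h.inj 0 (by omega) ℓ le_rfl hmi
      subst this; simp at hℓ
    rcases hi.lt_or_eq with hlt | rfl
    · rcases Nat.even_or_odd i with he | ho
      · obtain ⟨k, rfl⟩ : ∃ k, i = k + 1 := ⟨i - 1, by omega⟩
        have hk : Odd k := by
          by_contra hc; exact Nat.not_odd_iff_even.2 he (Nat.not_odd_iff_even.1 hc).add_one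
        rw [h.odd_succ hm.invol (by omega) hk] at hmi
        exact absurd (h.inj k (by omega) ℓ le_rfl hmi) (by omega)
      · rw [h.odd i hlt ho] at hmi
        have := h.inj (i + 1) (by omega) ℓ le_rfl hmi
        exact Nat.not_even_iff_odd.2 hℓ (this ▸ ho.add_one)
    · exact hend e.symm
  refine ⟨fun i hi j hj hij => ?_, fun i hi => ?_, fun i hi ho => ?_, fun i hi he => ?_⟩
  · by_cases h1 : i ≤ ℓ <;> by_cases h2 : j ≤ ℓ <;> simp only [h1, h2, if_true, if_false] at hij
    · exact h.inj i h1 j h2 hij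
    · exact absurd hij (hnew i h1)
    · exact absurd hij.symm (hnew j h2)
    · omega
  · rcases (Nat.lt_succ_iff.1 hi).lt_or_eq with hlt | rfl
    · simpa [hlt.le, Nat.succ_le_of_lt hlt] using h.adj i hlt
    · simpa using hm.adj _ hend
  · rcases (Nat.lt_succ_iff.1 hi).lt_or_eq with hlt | rfl
    · simpa [hlt.le, Nat.succ_le_of_lt hlt] using h.odd i hlt ho
    · simp
  · have hlt : i < ℓ := lt_of_le_of_ne (Nat.lt_succ_iff.1 hi) fun e =>
      Nat.not_even_iff_odd.2 hℓ (e ▸ he)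
    simpa [hlt.le, Nat.succ_le_of_lt hlt] using h.even i hlt he

/-- The symmetric difference of `m` and an even alternating path, without the matching edge of `m`
at the start of the path, if there is one. -/
theorem exists_matching [DecidableEq V] (h : IsAltSeq G m a ℓ) (hm : IsMate G m) (hℓ : Even ℓ) :
    ∃ n, IsMate G n ∧ (∀ i < ℓ, Even i → n (a i) = a (i + 1)) ∧
      (∀ i < ℓ, Even i → n (a (i + 1)) = a i) ∧ n (a ℓ) = a ℓ ∧
      ∀ v, (∀ i ≤ ℓ, a i ≠ v) → n v = if v = m (a 0) then v else m v := by
  classical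
  set idx : V → ℕ := fun v => if hv : ∃ i ≤ ℓ, a i = v then hv.choose else 0 with hidx
  have hidx_eq : ∀ i ≤ ℓ, idx (a i) = i := by
    intro i hi
    have hv : ∃ j ≤ ℓ, a j = a i := ⟨i, hi, rfl⟩
    simp only [hidx, hv, dif_pos]
    exact h.inj _ hv.choose_spec.1 _ hi hv.choose_spec.2
  set n : V → V := fun v => if ∃ i ≤ ℓ, a i = v then
      (if idx v = ℓ then v else if Even (idx v) then a (idx v + 1) else a (idx v - 1))
    else if v = m (a 0) then v else m v with hn
  have hlast : n (a ℓ) = a ℓ := by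
    have : ∃ j ≤ ℓ, a j = a ℓ := ⟨ℓ, le_rfl, rfl⟩
    simp only [hn]
    rw [if_pos this, hidx_eq ℓ le_rfl, if_pos rfl]
  have hevn : ∀ i < ℓ, Even i → n (a i) = a (i + 1) := by
    intro i hi he
    have hex : ∃ j ≤ ℓ, a j = a i := ⟨i, hi.le, rfl⟩
    simp [hn, hex, hidx_eq i hi.le, hi.ne, he]
  have hodn : ∀ i < ℓ, Even i → n (a (i + 1)) = a i := by
    intro i hi he
    have hex : ∃ j ≤ ℓ, a j = a (i + 1) := ⟨i + 1, hi, rfl⟩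
    have ho : ¬ Even (i + 1) := Nat.not_even_iff_odd.2 he.add_one
    have hne : i + 1 ≠ ℓ := fun e => ho (e ▸ hℓ)
    simp [hn, hex, hidx_eq (i + 1) hi, hne, ho]
  have hoff : ∀ v, (∀ i ≤ ℓ, a i ≠ v) → n v = if v = m (a 0) then v else m v := by
    intro v hv
    have : ¬ ∃ i ≤ ℓ, a i = v := by push Not; exact hv
    simp [hn, this]
  have hodd_pred : ∀ i, ¬ Even i → ∃ k, i = k + 1 ∧ Even k := fun i hi => by
    rw [Nat.not_even_iff_odd] at hi
    obtain ⟨k, rfl⟩ := hi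
    exact ⟨2 * k, rfl, even_two_mul k⟩
  refine ⟨n, ⟨fun v => ?_, fun v hv => ?_⟩, hevn, hodn, hlast, hoff⟩
  · by_cases hon : ∃ i ≤ ℓ, a i = v
    · obtain ⟨i, hi, rfl⟩ := hon
      rcases hi.lt_or_eq with hlt | rfl
      · by_cases he : Even i
        · rw [hevn i hlt he, hodn i hlt he]
        · obtain ⟨k, rfl, hk⟩ := hodd_pred i he
          rw [hodn k (by omega) hk, hevn k (by omega) hk]
      · rw [hlast, hlast]
    · push Not at hon
      rw [hoff v hon]
      by_cases hv0 : v = m (a 0)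
      · rw [if_pos hv0, hoff v hon, if_pos hv0]
      · rw [if_neg hv0]
        have hoffm : ∀ i ≤ ℓ, a i ≠ m v := by
          intro i hi e
          rcases Nat.eq_zero_or_pos i with rfl | hpos
          · exact hv0 (by rw [e, hm.invol])
          · obtain ⟨j, hj, -, -, hmj⟩ := h.mate_mem hm.invol hℓ hi hpos.ne'
            exact hon j hj (by rw [← hmj, e, hm.invol])
        rw [hoff _ hoffm, hm.invol]
        split_ifs with h'
        · exact absurd (by rw [← hm.invol v, h', hm.invol]) (hon 0 (Nat.zero_le _))
        · rfl
  · by_cases hon : ∃ i ≤ ℓ, a i = v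
    · obtain ⟨i, hi, rfl⟩ := hon
      rcases hi.lt_or_eq with hlt | rfl
      · by_cases he : Even i
        · rw [hevn i hlt he]; exact h.adj i hlt
        · obtain ⟨k, rfl, hk⟩ := hodd_pred i he
          rw [hodn k (by omega) hk]; exact (h.adj k (by omega)).symm
      · exact absurd hlast hv
    · push Not at hon
      rw [hoff v hon] at hv ⊢
      split_ifs at hv ⊢ with h'
      · exact absurd rfl hv
      · exact hm.adj v hv

end IsAltSeq

variable [Fintype V] [DecidableEq V]

/-- The duality gap of the matching obtained from an even alternating path. -/
theorem IsAltSeq.gap_eq (h : IsAltSeq G m a ℓ) (hm : IsMate G m) (hℓ : Even ℓ) {n : V → V}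
    (hev : ∀ i < ℓ, Even i → n (a i) = a (i + 1))
    (hod : ∀ i < ℓ, Even i → n (a (i + 1)) = a i) (hlast : n (a ℓ) = a ℓ)
    (hoff : ∀ v, (∀ i ≤ ℓ, a i ≠ v) → n v = if v = m (a 0) then v else m v) (y : V → ℤ) :
    gap m y n = ℓ - y (a ℓ) + if m (a 0) = a 0 then y (a 0) else 2 - y (m (a 0)) := by
  have hinj : Set.InjOn a (Finset.range (ℓ + 1)) := by
    intro i hi j hj hij
    simp only [Finset.coe_range, Set.mem_Iio] at hi hj
    exact h.inj i (by omega) j (by omega) hij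
  set P := (Finset.range (ℓ + 1)).image a with hP
  have hmemP : ∀ v, v ∉ P → ∀ i ≤ ℓ, a i ≠ v := by
    intro v hv i hi e
    exact hv (Finset.mem_image.2 ⟨i, Finset.mem_range.2 (by omega), e⟩)
  have h1 : ∑ v ∈ P, psi m y v (n v) = ℓ + (1 - y (a ℓ)) := by
    rw [hP, Finset.sum_image hinj, Finset.sum_range_succ]
    congr 1
    · have : ∀ i ∈ Finset.range ℓ, psi m y (a i) (n (a i)) = 1 := by
        intro i hi
        have hi' := Finset.mem_range.1 hi
        rcases Nat.even_or_odd i with he | ho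
        · have h2 : a (i + 1) ≠ a i := (h.adj i hi').ne'
          rw [hev i hi' he, psi, if_neg h2, if_neg (h.even i hi' he).symm]
        · obtain ⟨k, rfl⟩ : ∃ k, i = k + 1 := ⟨i - 1, by have := ho.pos; omega⟩
          have hk : Even k := by
            by_contra hc; exact Nat.not_even_iff_odd.2 ho (Nat.not_even_iff_odd.1 hc).add_one
          have h2 : a k ≠ a (k + 1) := (h.adj k (by omega)).ne
          have h3 : a k ≠ m (a (k + 1)) := by
            rw [h.odd _ hi' ho]
            exact fun e => absurd (h.inj _ (by omega) _ (by omega) e) (by omega)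
          rw [hod k (by omega) hk, psi, if_neg h2, if_neg h3]
      rw [Finset.sum_congr rfl this]; simp
    · simp [hlast, psi]
  have h2 : ∑ v ∈ P, psi m y v (m v) = if m (a 0) = a 0 then 1 - y (a 0) else 0 := by
    rw [hP, Finset.sum_image hinj, Finset.sum_range_succ', Finset.sum_eq_zero, zero_add]
    · simp [psi]
    · intro i hi
      have hi' := Finset.mem_range.1 hi
      have := h.mate_ne hm.invol hℓ (i := i + 1) (by omega) (by omega)
      simp [psi, this]
  have h3 : ∑ v ∈ Pᶜ, (psi m y v (n v) - psi m y v (m v))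
      = if m (a 0) = a 0 then 0 else 1 - y (m (a 0)) := by
    have hz : ∀ v ∈ Pᶜ, v ≠ m (a 0) → psi m y v (n v) - psi m y v (m v) = 0 := by
      intro v hv hne
      rw [hoff v (hmemP v (Finset.mem_compl.1 hv)), if_neg hne, sub_self]
    split_ifs with h0
    · refine Finset.sum_eq_zero fun v hv => hz v hv fun e => ?_
      exact hmemP v (Finset.mem_compl.1 hv) 0 (Nat.zero_le _) (by rw [e, h0])
    · have hmem : m (a 0) ∉ P := by
        intro hc
        obtain ⟨i, hi, e⟩ := Finset.mem_image.1 hc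
        rcases Nat.eq_zero_or_pos i with rfl | hpos
        · exact h0 e.symm
        · exact h.mate_start_ne hm.invol hℓ (Nat.lt_succ_iff.1 (Finset.mem_range.1 hi)) hpos.ne'
            e.symm
      rw [Finset.sum_eq_single (m (a 0)) hz fun hc => absurd (Finset.mem_compl.2 hmem) hc,
        hoff _ (hmemP _ hmem), if_pos rfl]
      simp [psi, hm.invol, Ne.symm h0]
  rw [gap, ← Finset.sum_add_sum_compl P, h3, Finset.sum_sub_distrib, h1, h2]
  split_ifs <;> ring

variable {Δ : ℕ}

/-- The length of an even alternating path is bounded below by the dual solution. -/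
theorem IsOptimal.dual_y_le_length (hopt : IsOptimal G m (dual G m Δ)) (h : IsAltSeq G m a ℓ)
    (hℓ : Even ℓ) (h0 : m (a 0) = a 0) : (dual G m Δ).y (a ℓ) + Δ - 1 ≤ ℓ := by
  obtain ⟨n, hn, hev, hod, hlast, hoff⟩ := h.exists_matching hopt.mate hℓ
  have hg := h.gap_eq hopt.mate hℓ hev hod hlast hoff (dual G m Δ).y
  have := hopt.gap_nonneg n hn
  rw [if_pos h0, dual_y_of_fixed hopt.mate h0] at hg
  linarith

/-- The same for a path that starts at a covered vertex. -/
theorem IsOptimal.dual_y_le_length_add (hopt : IsOptimal G m (dual G m Δ))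
    (h : IsAltSeq G m a ℓ) (hℓ : Even ℓ) (h0 : m (a 0) ≠ a 0)
    (hz : (dual G m Δ).z (a 0) (m (a 0)) = 0) :
    (dual G m Δ).y (a ℓ) ≤ ℓ + (dual G m Δ).y (a 0) := by
  obtain ⟨n, hn, hev, hod, hlast, hoff⟩ := h.exists_matching hopt.mate hℓ
  have hg := h.gap_eq hopt.mate hℓ hev hod hlast hoff (dual G m Δ).y
  have := hopt.gap_nonneg n hn
  rw [if_neg h0] at hg
  have hs := (hopt.tight_mate h0).2
  simp only [slack, hz, if_true] at hs
  linarith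

/-- A path that attains the lower bound ends at an outer vertex. -/
theorem IsOptimal.outer_of_length_eq (hopt : IsOptimal G m (dual G m Δ))
    (h : IsAltSeq G m a ℓ) (hℓ : Even ℓ) (h0 : m (a 0) = a 0)
    (hlen : (ℓ : ℤ) = (dual G m Δ).y (a ℓ) + Δ - 1) :
    Outer G m (dual G m Δ) (a ℓ) := by
  rcases Nat.eq_zero_or_pos ℓ with rfl | hpos
  · exact outer_of_fixed hopt.mate h0
  obtain ⟨n, hn, hev, hod, hlast, hoff⟩ := h.exists_matching hopt.mate hℓ
  have hg := h.gap_eq hopt.mate hℓ hev hod hlast hoff (dual G m Δ).y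
  rw [if_pos h0, dual_y_of_fixed hopt.mate h0] at hg
  refine ⟨n, hn, by linarith, ?_, hlast⟩
  refine fixCard_exchange (x := a ℓ) (e := a 0) h0
    (h.mate_ne hopt.mate.invol hℓ le_rfl hpos.ne') fun v => ?_
  by_cases hon : ∃ i ≤ ℓ, a i = v
  · obtain ⟨i, hi, rfl⟩ := hon
    have hR : (m (a i) = a i ∧ a i ≠ a 0) ↔ False := by
      refine iff_false_intro fun ⟨h1, h2⟩ => ?_
      exact h.mate_ne hopt.mate.invol hℓ hi (fun e => h2 (by rw [e])) h1
    rw [hR, or_false]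
    refine ⟨fun hfix => ?_, fun e => by rw [e, hlast]⟩
    by_contra hne
    have hlt : i < ℓ := lt_of_le_of_ne hi fun e => hne (by rw [e])
    rcases Nat.even_or_odd i with he | ho
    · rw [hev i hlt he] at hfix
      exact (h.adj i hlt).ne' hfix
    · obtain ⟨k, rfl⟩ : ∃ k, i = k + 1 := ⟨i - 1, by have := ho.pos; omega⟩
      have hk : Even k := by
        by_contra hc; exact Nat.not_even_iff_odd.2 ho (Nat.not_even_iff_odd.1 hc).add_one
      rw [hod k (by omega) hk] at hfix
      exact (h.adj k (by omega)).ne hfix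
  · push Not at hon
    have hv0 : v ≠ m (a 0) := fun e => hon 0 (Nat.zero_le _) (by rw [e, h0])
    have hvl : v ≠ a ℓ := (hon ℓ le_rfl).symm
    have hva : v ≠ a 0 := (hon 0 (Nat.zero_le _)).symm
    rw [hoff v hon, if_neg hv0]
    simp [hvl, hva]

/-- An outer vertex is reached by an even alternating path of the length given by the dual
solution. -/
theorem IsOptimal.exists_isAltSeq (hopt : IsOptimal G m (dual G m Δ)) {x : V}
    (hx : Outer G m (dual G m Δ) x) : ∃ a ℓ, IsAltSeq G m a ℓ ∧ Even ℓ ∧ m (a 0) = a 0 ∧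
      a ℓ = x ∧ (ℓ : ℤ) = (dual G m Δ).y x + Δ - 1 := by
  by_cases hmx : m x = x
  · refine ⟨fun _ => x, 0, ⟨fun i hi j hj _ => by omega, by simp, by simp, by simp⟩, by simp, hmx,
      rfl, ?_⟩
    rw [dual_y_of_fixed hopt.mate hmx]; simp
  obtain ⟨e, n, hn, hg, he, hne, hf⟩ := hopt.exists_exchange hx hmx
  obtain ⟨a, ℓ, hz, h0, hend⟩ := exists_isZigzag hn.invol hopt.mate.invol he
  have h00 : m (a 0) = a 0 := by rw [h0, he]
  have hcost := hz.le_cost (n := n) hn.invol hopt.mate.invol h00 fun _ _ => rfl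
  rw [gap_eq_of_exchange he hmx hf, dual_y_of_fixed hopt.mate he] at hg
  have halt := hz.isAltSeq hn hopt.mate h00
  rcases hend with ⟨hℓ, hfix⟩ | ⟨hℓ, hfix⟩
  · have hℓ0 : ℓ ≠ 0 := by
      rintro rfl; rw [h0] at hfix; exact hne hfix
    have hend : a ℓ = x := by
      rcases (hf _).1 hfix with h | h
      · exact h
      · exact absurd h.1 (hz.snd_ne hopt.mate.invol le_rfl hℓ0 fun _ => hℓ)
    have hlow := hopt.dual_y_le_length halt hℓ h00
    rw [hend] at hlow
    refine ⟨a, ℓ, halt, hℓ, h00, hend, ?_⟩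
    have : (ℓ : ℤ) ≤ cost m n := by exact_mod_cast hcost
    linarith
  · exfalso
    have hne' : a ℓ ≠ e := fun h => by
      have := hz.inj 0 (by omega) ℓ le_rfl (h0.trans h.symm)
      subst this; simp at hℓ
    exact hz.fst_ne hn.invol le_rfl (fun _ => hℓ) ((hf _).2 (.inr ⟨hfix, hne'⟩))

/-- A vertex at even position on a shortest even alternating path to an outer vertex is outer, and
the path up to it is shortest, unless the vertex and its mate lie in a common earlier blossom. -/
theorem IsOptimal.outer_prefix (hopt : IsOptimal G m (dual G m Δ)) (h : IsAltSeq G m a ℓ)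
    (hℓ : Even ℓ) (h0 : m (a 0) = a 0) (hlen : (ℓ : ℤ) = (dual G m Δ).y (a ℓ) + Δ - 1)
    {k : ℕ} (hk : k ≤ ℓ) (hev : Even k)
    (hz : m (a k) = a k ∨ (dual G m Δ).z (a k) (m (a k)) = 0) :
    Outer G m (dual G m Δ) (a k) ∧ (k : ℤ) = (dual G m Δ).y (a k) + Δ - 1 := by
  rcases Nat.eq_zero_or_pos k with rfl | hpos
  · refine ⟨outer_of_fixed hopt.mate h0, ?_⟩
    rw [dual_y_of_fixed hopt.mate h0]; simp
  have hmk := h.mate_ne hopt.mate.invol hℓ hk hpos.ne'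
  have hz := hz.resolve_left hmk
  have h1 := hopt.dual_y_le_length (h.take hk) hev h0
  have hsub : Even (ℓ - k) := (Nat.even_sub hk).2 ⟨fun _ => hev, fun _ => hℓ⟩
  have h2 := hopt.dual_y_le_length_add (h.drop hk hev) hsub hmk hz
  simp only [add_zero, Nat.add_sub_cancel' hk] at h2
  push_cast [hk] at h2
  have heq : (k : ℤ) = (dual G m Δ).y (a k) + Δ - 1 := by linarith
  exact ⟨hopt.outer_of_length_eq (h.take hk) hev h0 heq, heq⟩

end PathMatching

/-! ### Levels and tenacity in terms of the dual solutions -/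

section Mate

variable {V : Type*} {G : SimpleGraph V} {M : G.Subgraph}

open Classical in
/-- The mate of a vertex in `M`, or the vertex itself if it is unmatched. -/
noncomputable def mate (M : G.Subgraph) (v : V) : V :=
  if h : ∃ w, M.Adj v w then h.choose else v

theorem mate_eq (hM : M.IsMatching) {v w : V} (h : M.Adj v w) : mate M v = w := by
  have hex : ∃ w, M.Adj v w := ⟨w, h⟩
  rw [mate, dif_pos hex]
  exact (hM h.fst_mem).unique hex.choose_spec h

theorem adj_mate {v : V} (h : mate M v ≠ v) : M.Adj v (mate M v) := by
  by_cases hex : ∃ w, M.Adj v w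
  · rw [mate, dif_pos hex]; exact hex.choose_spec
  · rw [mate, dif_neg hex] at h; exact absurd rfl h

theorem adj_iff_mate_eq (hM : M.IsMatching) {v w : V} (hne : v ≠ w) :
    M.Adj v w ↔ mate M v = w :=
  ⟨mate_eq hM, fun h => h ▸ adj_mate (by rw [h]; exact hne.symm)⟩

theorem unmatched_iff (hM : M.IsMatching) {f : V} : Unmatched M f ↔ mate M f = f := by
  constructor
  · intro h
    by_contra hne
    exact h _ (adj_mate hne)
  · intro h w hw
    rw [mate_eq hM hw] at h
    exact hw.ne h.symm

theorem isMate_mate (hM : M.IsMatching) : IsMate G (mate M) where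
  invol v := by
    by_cases h : mate M v = v
    · rw [h, h]
    · exact mate_eq hM (adj_mate h).symm
  adj _ h := (adj_mate h).adj_sub

theorem isAltSeq_getVert (hM : M.IsMatching) {f v : V} {p : G.Walk f v} (hf : Unmatched M f)
    (hp : IsAltPath M p) : IsAltSeq G (mate M) p.getVert p.length := by
  obtain ⟨hpath, hchain⟩ := hp
  rw [List.isChain_iff_getElem] at hchain
  have hmem : ∀ i < p.length, M.Adj (p.getVert i) (p.getVert (i + 1)) ↔ Odd i := by
    intro i
    induction i with
    | zero =>
      intro _
      simpa using hf _
    | succ i ih =>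
      intro hi
      have hc := hchain i (by simpa using hi)
      rw [SimpleGraph.Walk.getElem_edges, SimpleGraph.Walk.getElem_edges,
        SimpleGraph.Subgraph.mem_edgeSet, SimpleGraph.Subgraph.mem_edgeSet, ih (by omega)] at hc
      rw [Nat.odd_add_one]
      tauto
  have hadj : ∀ i < p.length, G.Adj (p.getVert i) (p.getVert (i + 1)) :=
    fun i hi => p.adj_getVert_succ hi
  exact ⟨fun i hi j hj hij => hpath.getVert_injOn hi hj hij, hadj,
    fun i hi ho => mate_eq hM ((hmem i hi).2 ho),
    fun i hi he h => Nat.not_odd_iff_even.2 he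
      ((hmem i hi).1 ((adj_iff_mate_eq hM (hadj i hi).ne).2 h))⟩

theorem exists_walk_of_adj {a : ℕ → V} {ℓ : ℕ} (h : ∀ i < ℓ, G.Adj (a i) (a (i + 1))) :
    ∃ p : G.Walk (a 0) (a ℓ), p.length = ℓ ∧ ∀ i ≤ ℓ, p.getVert i = a i := by
  induction ℓ generalizing a with
  | zero => exact ⟨.nil, rfl, fun i hi => by simp [Nat.le_zero.1 hi]⟩
  | succ ℓ ih =>
    obtain ⟨p, hp, hv⟩ := ih (a := fun i => a (i + 1)) fun i hi => h (i + 1) (by omega)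
    refine ⟨.cons (h 0 (by omega)) p, by simp [hp], fun i hi => ?_⟩
    rcases i with _ | i
    · simp
    · rw [SimpleGraph.Walk.getVert_cons_succ]; exact hv i (by omega)

theorem IsAltSeq.exists_walk (hM : M.IsMatching) {a : ℕ → V} {ℓ : ℕ}
    (h : IsAltSeq G (mate M) a ℓ) : ∃ p : G.Walk (a 0) (a ℓ), IsAltPath M p ∧ p.length = ℓ := by
  obtain ⟨p, hp, hv⟩ := exists_walk_of_adj h.adj
  refine ⟨p, ⟨?_, ?_⟩, hp⟩
  · rw [← SimpleGraph.Walk.IsPath.getVert_injOn_iff]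
    intro i hi j hj hij
    rw [Set.mem_ofPred_eq, hp] at hi hj
    rw [hv i hi, hv j hj] at hij
    exact h.inj i hi j hj hij
  · rw [List.isChain_iff_getElem]
    intro i hi
    rw [SimpleGraph.Walk.length_edges, hp] at hi
    have hmem : ∀ j < ℓ, M.Adj (a j) (a (j + 1)) ↔ Odd j := by
      intro j hj
      rw [adj_iff_mate_eq hM (h.adj j hj).ne]
      refine ⟨fun e => ?_, h.odd j hj⟩
      by_contra hc
      exact h.even j hj (Nat.not_odd_iff_even.1 hc) e
    rw [SimpleGraph.Walk.getElem_edges, SimpleGraph.Walk.getElem_edges,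
      SimpleGraph.Subgraph.mem_edgeSet, SimpleGraph.Subgraph.mem_edgeSet, hv i (by omega),
      hv (i + 1) (by omega), hv (i + 1 + 1) (by omega), hmem i (by omega), hmem (i + 1) hi,
      Nat.odd_add_one]
    tauto

theorem IsAltSeq.evenlevel_le (hM : M.IsMatching) {a : ℕ → V} {ℓ : ℕ}
    (h : IsAltSeq G (mate M) a ℓ) (h0 : mate M (a 0) = a 0) (hℓ : Even ℓ) :
    evenlevel M (a ℓ) ≤ ℓ := by
  obtain ⟨p, hp, hlen⟩ := h.exists_walk hM
  exact sInf_le ⟨a 0, p, (unmatched_iff hM).2 h0, hp, by rwa [hlen], by rw [hlen]⟩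

theorem IsAltSeq.oddlevel_le (hM : M.IsMatching) {a : ℕ → V} {ℓ : ℕ}
    (h : IsAltSeq G (mate M) a ℓ) (h0 : mate M (a 0) = a 0) (hℓ : Odd ℓ) :
    oddlevel M (a ℓ) ≤ ℓ := by
  obtain ⟨p, hp, hlen⟩ := h.exists_walk hM
  exact sInf_le ⟨a 0, p, (unmatched_iff hM).2 h0, hp, by rwa [hlen], by rw [hlen]⟩

theorem exists_isAltSeq_evenlevel (hM : M.IsMatching) {v : V} (h : evenlevel M v ≠ ⊤) :
    ∃ a ℓ, IsAltSeq G (mate M) a ℓ ∧ Even ℓ ∧ mate M (a 0) = a 0 ∧ a ℓ = v ∧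
      evenlevel M v = ℓ := by
  have hne : {n : ℕ∞ | ∃ (f : V) (p : G.Walk f v),
      Unmatched M f ∧ IsAltPath M p ∧ Even p.length ∧ n = (p.length : ℕ∞)}.Nonempty := by
    rw [Set.nonempty_iff_ne_empty]
    intro he
    exact h (by rw [evenlevel, he, sInf_empty])
  obtain ⟨f, p, hf, hp, hev, heq⟩ := csInf_mem hne
  exact ⟨p.getVert, p.length, isAltSeq_getVert hM hf hp, hev, by
    rw [p.getVert_zero]; exact (unmatched_iff hM).1 hf, p.getVert_length, heq⟩

theorem exists_isAltSeq_oddlevel (hM : M.IsMatching) {v : V} (h : oddlevel M v ≠ ⊤) :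
    ∃ a ℓ, IsAltSeq G (mate M) a ℓ ∧ Odd ℓ ∧ mate M (a 0) = a 0 ∧ a ℓ = v ∧
      oddlevel M v = ℓ := by
  have hne : {n : ℕ∞ | ∃ (f : V) (p : G.Walk f v),
      Unmatched M f ∧ IsAltPath M p ∧ Odd p.length ∧ n = (p.length : ℕ∞)}.Nonempty := by
    rw [Set.nonempty_iff_ne_empty]
    intro he
    exact h (by rw [oddlevel, he, sInf_empty])
  obtain ⟨f, p, hf, hp, hod, heq⟩ := csInf_mem hne
  exact ⟨p.getVert, p.length, isAltSeq_getVert hM hf hp, hod, by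
    rw [p.getVert_zero]; exact (unmatched_iff hM).1 hf, p.getVert_length, heq⟩

theorem evenlevel_mate (hM : M.IsMatching) {v : V} (hv : mate M v ≠ v) :
    evenlevel M (mate M v) = oddlevel M v + 1 := by
  have hm := isMate_mate hM
  apply le_antisymm
  · by_cases htop : oddlevel M v = ⊤
    · simp [htop]
    obtain ⟨a, ℓ, ha, hℓ, h0, rfl, heq⟩ := exists_isAltSeq_oddlevel hM htop
    have := (ha.extend hm hℓ h0 hv).evenlevel_le hM (by simpa using h0) hℓ.add_one
    simpa [heq] using this
  · by_cases htop : evenlevel M (mate M v) = ⊤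
    · simp [htop]
    obtain ⟨a, ℓ, ha, hℓ, h0, hend, heq⟩ := exists_isAltSeq_evenlevel hM htop
    have hℓ0 : ℓ ≠ 0 := by
      rintro rfl
      rw [hend, hm.invol] at h0
      exact hv h0.symm
    obtain ⟨k, rfl⟩ := Nat.exists_eq_succ_of_ne_zero hℓ0
    have hk : Odd k := by
      by_contra hc
      exact Nat.not_even_iff_odd.2 (Nat.not_odd_iff_even.1 hc).add_one hℓ
    have hkv : a k = v := by
      rw [← ha.odd_succ hm.invol (Nat.lt_succ_self k) hk]
      exact (congrArg (mate M) hend).trans (hm.invol v)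
    have := (ha.take (Nat.le_succ k)).oddlevel_le hM h0 hk
    rw [hkv] at this
    rw [heq]
    push_cast
    gcongr

theorem tenacity_add_one (hM : M.IsMatching) {v : V} (hv : mate M v ≠ v) :
    tenacity M v + 1 = evenlevel M v + evenlevel M (mate M v) := by
  rw [evenlevel_mate hM hv, tenacity, add_assoc]

theorem augLength_le_tenacity (hM : M.IsMatching) {f : V} (hf : mate M f = f) :
    augLength M ≤ tenacity M f := by
  refine le_trans (le_sInf ?_) (le_add_left le_rfl)
  rintro n ⟨g, p, hg, hp, hod, rfl⟩
  refine sInf_le ⟨g, f, p, hg, (unmatched_iff hM).2 hf, ?_, hp, rfl⟩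
  rintro rfl
  rw [SimpleGraph.Walk.length_eq_zero_iff.2 (SimpleGraph.Walk.isPath_iff_nil.1 hp.1)] at hod
  simp at hod

theorem noShortAugmentation (hM : M.IsMatching) {Δ : ℕ} (h : ((2 * Δ : ℕ) : ℕ∞) ≤ augLength M) :
    NoShortAugmentation G (mate M) Δ := by
  intro a ℓ ha hℓ h0 hend
  obtain ⟨p, hp, hlen⟩ := ha.exists_walk hM
  have hle : augLength M ≤ (ℓ : ℕ∞) := by
    refine sInf_le ⟨a 0, a ℓ, p, (unmatched_iff hM).2 h0, (unmatched_iff hM).2 hend, fun e => ?_,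
      hp, by rw [hlen]⟩
    have := ha.inj 0 (by omega) ℓ le_rfl e
    subst this; simp at hℓ
  exact_mod_cast h.trans hle

theorem mate_ne_of_tenacity_lt (hM : M.IsMatching) {v : V} (h : tenacity M v < augLength M) :
    mate M v ≠ v := fun e => not_lt_of_ge (augLength_le_tenacity hM e) h

/-- Tenacities less than `l_m` are odd. -/
theorem exists_two_mul_eq (hM : M.IsMatching) {v : V} (h : tenacity M v < augLength M) :
    ∃ Δ : ℕ, tenacity M v + 1 = ((2 * Δ : ℕ) : ℕ∞) ∧ ((2 * Δ : ℕ) : ℕ∞) ≤ augLength M := by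
  have hv := mate_ne_of_tenacity_lt hM h
  have hle : tenacity M v + 1 ≤ augLength M := Order.add_one_le_of_lt h
  have hfin : tenacity M v + 1 ≠ ⊤ := by
    simpa using (ne_top_of_lt h)
  have hsum := tenacity_add_one hM hv
  rw [hsum] at hfin
  obtain ⟨h1, h2⟩ := WithTop.add_ne_top.1 hfin
  obtain ⟨_, k, -, ⟨i, hi⟩, -, -, hk⟩ := exists_isAltSeq_evenlevel hM h1
  obtain ⟨_, l, -, ⟨j, hj⟩, -, -, hl⟩ := exists_isAltSeq_evenlevel hM h2
  have : tenacity M v + 1 = ((2 * (i + j) : ℕ) : ℕ∞) := by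
    rw [hsum, hk, hl, hi, hj]; push_cast; ring
  exact ⟨i + j, this, this ▸ hle⟩

end Mate

section Levels

variable {V : Type*} [Fintype V] [DecidableEq V] {G : SimpleGraph V} {M : G.Subgraph} {Δ : ℕ}

theorem evenlevel_of_outer (hM : M.IsMatching) (hopt : IsOptimal G (mate M) (dual G (mate M) Δ))
    {x : V} (hx : Outer G (mate M) (dual G (mate M) Δ) x) :
    ∃ k : ℕ, evenlevel M x = k ∧ (k : ℤ) = (dual G (mate M) Δ).y x + Δ - 1 := by
  obtain ⟨a, ℓ, ha, hℓ, h0, rfl, hlen⟩ := hopt.exists_isAltSeq hx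
  have hle := ha.evenlevel_le hM h0 hℓ
  obtain ⟨b, k, hb, hk, hb0, hbk, heq⟩ :=
    exists_isAltSeq_evenlevel hM (ne_top_of_le_ne_top (ENat.natCast_ne_top ℓ) hle)
  refine ⟨k, heq, le_antisymm ?_ ?_⟩
  · rw [heq] at hle
    have : k ≤ ℓ := by exact_mod_cast hle
    omega
  · rw [← hbk]; exact hopt.dual_y_le_length hb hk hb0

/-- The vertices of tenacity less than `2 * Δ` are the outer vertices with outer mates. -/
theorem tenacity_add_one_le_iff (hM : M.IsMatching) (hL : NoShortAugmentation G (mate M) Δ)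
    {v : V} (hv : mate M v ≠ v) : tenacity M v + 1 ≤ ((2 * Δ : ℕ) : ℕ∞) ↔
      Outer G (mate M) (dual G (mate M) Δ) v ∧
        Outer G (mate M) (dual G (mate M) Δ) (mate M v) := by
  have hopt := isOptimal_dual (isMate_mate hM) hL
  have hs := (hopt.tight_mate hv).2
  simp only [slack, if_true] at hs
  rw [tenacity_add_one hM hv]
  constructor
  · intro hle
    obtain ⟨h1, h2⟩ := WithTop.add_ne_top.1 (ne_top_of_le_ne_top (ENat.natCast_ne_top _) hle)
    obtain ⟨a, k, ha, hk, ha0, hak, hk'⟩ := exists_isAltSeq_evenlevel hM h1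
    obtain ⟨b, l, hb, hl, hb0, hbl, hl'⟩ := exists_isAltSeq_evenlevel hM h2
    rw [hk', hl'] at hle
    have hle' : k + l ≤ 2 * Δ := by exact_mod_cast hle
    rcases (dual_z_nonneg (G := G) (m := mate M) Δ v (mate M v)).eq_or_lt with hz | hz
    · -- The two lower bounds add up to `2 * Δ`, so both are attained.
      have h3 := hopt.dual_y_le_length ha hk ha0
      have h4 := hopt.dual_y_le_length hb hl hb0
      rw [hak] at h3
      rw [hbl] at h4
      rw [← hz] at hs
      constructor
      · have := hopt.outer_of_length_eq ha hk ha0 (by rw [hak]; omega)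
        rwa [hak] at this
      · have := hopt.outer_of_length_eq hb hl hb0 (by rw [hbl]; omega)
        rwa [hbl] at this
    · obtain ⟨s, hsΔ, hr⟩ := exists_blossom_of_dual_z_pos hz
      obtain ⟨h3, h4⟩ := outer_of_blossom hr hv.symm
      exact ⟨outer_mono hopt.mate hsΔ.le h3, outer_mono hopt.mate hsΔ.le h4⟩
  · rintro ⟨h1, h2⟩
    obtain ⟨k, hk, hk'⟩ := evenlevel_of_outer hM hopt h1
    obtain ⟨l, hl, hl'⟩ := evenlevel_of_outer hM hopt h2
    have hz := hopt.z_nonneg v (mate M v)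
    rw [hk, hl]
    have : k + l ≤ 2 * Δ := by omega
    exact_mod_cast this

theorem dual_z_eq_zero_of_lt (hM : M.IsMatching) (hL : NoShortAugmentation G (mate M) Δ) {s : ℕ}
    (hs : s ≤ Δ) {v : V} (hv : mate M v ≠ v) (ht : ((2 * Δ : ℕ) : ℕ∞) ≤ tenacity M v + 1) :
    (dual G (mate M) s).z v (mate M v) = 0 := by
  refine le_antisymm (not_lt.1 fun hpos => ?_) (dual_z_nonneg s _ _)
  obtain ⟨r, hr, hb⟩ := exists_blossom_of_dual_z_pos hpos
  have hLr : NoShortAugmentation G (mate M) r := fun a ℓ h1 h2 h3 h4 => by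
    have := hL a ℓ h1 h2 h3 h4; omega
  have hle := (tenacity_add_one_le_iff hM hLr hv).2 (outer_of_blossom hb hv.symm)
  have : 2 * Δ ≤ 2 * r := by exact_mod_cast ht.trans hle
  omega

/-- A level path of a vertex `v` of tenacity at most `2 * Δ - 1`, extended by the matching edge at `v`
if its length is odd: an even alternating path that attains the bound given by the dual solution. -/
theorem IsLevelPath.exists_isAltSeq (hM : M.IsMatching) (hL : NoShortAugmentation G (mate M) Δ)
    {f v : V} {p : G.Walk f v} (hp : IsLevelPath M p) (hv : mate M v ≠ v)
    (ht : tenacity M v + 1 ≤ ((2 * Δ : ℕ) : ℕ∞)) :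
    ∃ a ℓ, IsAltSeq G (mate M) a ℓ ∧ Even ℓ ∧ mate M (a 0) = a 0 ∧
      (ℓ : ℤ) = (dual G (mate M) Δ).y (a ℓ) + Δ - 1 ∧ (∀ i ≤ p.length, a i = p.getVert i) ∧
      p.length ≤ ℓ ∧ ℓ ≤ p.length + 1 ∧ (a ℓ = v ∨ a ℓ = mate M v) := by
  have hm := isMate_mate hM
  have hopt := isOptimal_dual hm hL
  obtain ⟨ho, ho'⟩ := (tenacity_add_one_le_iff hM hL hv).1 ht
  rcases hp with ⟨hf, halt, hev, hlen⟩ | ⟨hf, halt, hod, hlen⟩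
  · have ha := isAltSeq_getVert hM hf halt
    obtain ⟨k, hk, hk'⟩ := evenlevel_of_outer hM hopt ho
    rw [hk] at hlen
    have hlen' : p.length = k := by exact_mod_cast hlen
    refine ⟨p.getVert, p.length, ha, hev, ?_, ?_, fun _ _ => rfl, le_rfl, by omega,
      .inl p.getVert_length⟩
    · rw [p.getVert_zero]; exact (unmatched_iff hM).1 hf
    · rw [p.getVert_length, hlen', hk']
  · have ha := isAltSeq_getVert hM hf halt
    obtain ⟨k, hk, hk'⟩ := evenlevel_of_outer hM hopt ho'
    rw [evenlevel_mate hM hv, ← hlen] at hk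
    have hlen' : p.length + 1 = k := by exact_mod_cast hk
    have h0 : mate M (p.getVert 0) = p.getVert 0 := by
      rw [p.getVert_zero]; exact (unmatched_iff hM).1 hf
    have hend : mate M (p.getVert p.length) ≠ p.getVert p.length := by rwa [p.getVert_length]
    refine ⟨_, p.length + 1, ha.extend hm hod h0 hend, hod.add_one, by simpa using h0, ?_,
      fun i hi => by simp [hi], by omega, le_rfl, .inr (by simp)⟩
    simp only [Nat.not_succ_le_self, if_false, p.getVert_length]
    rw [hlen', hk']

/-- The matching obtained from a path that attains the bound given by the dual solution. -/
theorem IsOptimal.exists_tight_matching {m : V → V} (hopt : IsOptimal G m (dual G m Δ))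
    {a : ℕ → V} {ℓ : ℕ} (h : IsAltSeq G m a ℓ) (hℓ : Even ℓ) (h0 : m (a 0) = a 0)
    (hlen : (ℓ : ℤ) = (dual G m Δ).y (a ℓ) + Δ - 1) :
    ∃ n, IsMate G n ∧ gap m (dual G m Δ).y n = 0 ∧ (∀ i < ℓ, Even i → n (a i) = a (i + 1)) ∧
      ∀ i < ℓ, Even i → n (a (i + 1)) = a i := by
  obtain ⟨n, hn, hev, hod, hlast, hoff⟩ := h.exists_matching hopt.mate hℓ
  have hg := h.gap_eq hopt.mate hℓ hev hod hlast hoff (dual G m Δ).y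
  rw [if_pos h0, dual_y_of_fixed hopt.mate h0] at hg
  exact ⟨n, hn, by linarith, hev, hod⟩

theorem IsOptimal.tight_of_length_eq {m : V → V} (hopt : IsOptimal G m (dual G m Δ))
    {a : ℕ → V} {ℓ : ℕ} (h : IsAltSeq G m a ℓ) (hℓ : Even ℓ) (h0 : m (a 0) = a 0)
    (hlen : (ℓ : ℤ) = (dual G m Δ).y (a ℓ) + Δ - 1) {i : ℕ} (hi : i < ℓ) :
    Tight G m (dual G m Δ) (a i) (a (i + 1)) := by
  obtain ⟨n, hn, hg, hev, -⟩ := hopt.exists_tight_matching h hℓ h0 hlen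
  have hne := (h.adj i hi).ne'
  rcases Nat.even_or_odd i with he | ho
  · have := hopt.slack_eq_zero n hn hg (a i) (by rwa [hev i hi he])
    rw [hev i hi he] at this
    exact ⟨h.adj i hi, this⟩
  · have := hopt.tight_mate (v := a i) (by rwa [h.odd i hi ho])
    rwa [h.odd i hi ho] at this

end Levels

/-! ### Bases on level paths -/

section Bases

variable {V : Type*} [Fintype V] [DecidableEq V] {G : SimpleGraph V} {M : G.Subgraph} {s Δ : ℕ}

/-- The base of a vertex `u` of tenacity `2 * s - 1` with respect to any level path is the deficit
of the blossom that contains `u` after `s` dual adjustments. -/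
theorem IsBaseWrt.isDeficit (hM : M.IsMatching) (hL : NoShortAugmentation G (mate M) s)
    {g u c : V} {q : G.Walk g u} (hq : IsLevelPath M q) (hu : mate M u ≠ u)
    (ht : tenacity M u + 1 = ((2 * s : ℕ) : ℕ∞)) (hc : IsBaseWrt M q c) :
    (blossom G (mate M) (dual G (mate M) s)).r c u ∧
      IsDeficit (blossom G (mate M) (dual G (mate M) s)).r (mate M) c := by
  have hm := isMate_mate hM
  have hopt := isOptimal_dual hm hL
  obtain ⟨i, hi, rfl, hlt, hafter⟩ := hc
  obtain ⟨a, ℓ, ha, hℓ, h0, hlen, haq, hqℓ, hℓq, hend⟩ :=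
    hq.exists_isAltSeq hM hL hu ht.le
  have huo := (tenacity_add_one_le_iff hM hL hu).1 ht.le
  -- The base itself is not an outer vertex with an outer mate; all later vertices are.
  have hbase : mate M (q.getVert i) ≠ q.getVert i →
      Outer G (mate M) (dual G (mate M) s) (q.getVert i) →
      ¬ Outer G (mate M) (dual G (mate M) s) (mate M (q.getVert i)) := by
    intro hne h1 h2
    have := (tenacity_add_one_le_iff hM hL hne).2 ⟨h1, h2⟩
    rw [← ht] at this
    exact not_le_of_gt hlt ((ENat.add_le_add_iff_right ENat.one_ne_top).1 this)
  have hout : ∀ j ≤ ℓ, i < j → Outer G (mate M) (dual G (mate M) s) (a j) ∧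
      Outer G (mate M) (dual G (mate M) s) (mate M (a j)) := by
    intro j hj hij
    by_cases hjq : j ≤ q.length
    · have hne := ha.mate_ne hm.invol hℓ hj (by omega)
      refine (tenacity_add_one_le_iff hM hL hne).1 ?_
      rw [← ht, haq j hjq]
      gcongr
      exact not_lt.1 (hafter j hjq hij)
    · have hjℓ : j = ℓ := by omega
      subst hjℓ
      rcases hend with h | h
      · rw [h]; exact huo
      · rw [h, hm.invol]; exact huo.symm
  have hiq : i < q.length := by
    refine lt_of_le_of_ne hi fun e => ?_
    rw [e, q.getVert_length] at hlt
    exact lt_irrefl _ hlt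
  have hai := haq i hi
  have hev : Even i := by
    by_contra hc
    have hod := ha.odd i (by omega) (Nat.not_even_iff_odd.1 hc)
    obtain ⟨h1, h2⟩ := hout (i + 1) (by omega) (by omega)
    rw [← hod, hm.invol, hai] at h2
    rw [← hod, hai] at h1
    refine hbase ?_ h2 h1
    rw [← hai, hod]
    exact (ha.adj i (by omega)).ne'
  have hprefix := hopt.outer_prefix ha hℓ h0 hlen (k := i) (by omega) hev (by
    by_cases hne : mate M (a i) = a i
    · exact .inl hne
    right
    by_contra hz
    have hpos := (dual_z_nonneg (G := G) (m := mate M) s (a i) (mate M (a i))).lt_of_ne' hz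
    obtain ⟨r, hr, hb⟩ := exists_blossom_of_dual_z_pos hpos
    obtain ⟨h1, h2⟩ := outer_of_blossom hb (Ne.symm hne)
    rw [hai] at hne h1 h2
    exact hbase hne (outer_mono hm hr.le h1) (outer_mono hm hr.le h2))
  have hio := hprefix.1
  have hchain : ∀ j ≤ ℓ, i ≤ j → (blossom G (mate M) (dual G (mate M) s)).r (a i) (a j) := by
    intro j hj hij
    induction hij with
    | refl => exact Setoid.refl' _ _
    | @step j hij ih =>
      refine Setoid.trans' _ (ih (by omega)) (Relation.EqvGen.rel _ _
        ⟨?_, (hout (j + 1) hj (by have : i ≤ j := hij; omega)).1,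
          hopt.tight_of_length_eq ha hℓ h0 hlen (by omega)⟩)
      rcases (show i ≤ j from hij).eq_or_lt with rfl | h
      · exact hio
      · exact (hout j (by omega) h).1
  constructor
  · have := hchain q.length hqℓ hi
    rwa [hai, haq _ le_rfl, q.getVert_length] at this
  · rw [hai] at hio
    by_contra hd
    rw [IsDeficit, not_or, not_not] at hd
    exact hbase hd.1 hio (outer_of_blossom hd.2 (Ne.symm hd.1)).2

/-- A level path of a vertex of tenacity greater than `2 * s - 1` passes through the deficit of each
blossom of the `s`-th dual solution that it meets: the matching obtained from the path leaves only
one deficit in the blossom, but the first and the last vertex of the path within the blossom would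
be two of them. -/
theorem deficit_mem_support (hM : M.IsMatching) (hL : NoShortAugmentation G (mate M) Δ)
    (hs : s < Δ) {f v u c : V} {p : G.Walk f v} (hp : IsLevelPath M p) (hv : mate M v ≠ v)
    (ht : tenacity M v + 1 = ((2 * Δ : ℕ) : ℕ∞)) (hu : u ∈ p.support)
    (hcu : (blossom G (mate M) (dual G (mate M) s)).r c u)
    (hcd : IsDeficit (blossom G (mate M) (dual G (mate M) s)).r (mate M) c) : c ∈ p.support := by
  classical
  have hm := isMate_mate hM
  have hopt := isOptimal_dual hm hL
  have hLs : NoShortAugmentation G (mate M) s := fun a ℓ h1 h2 h3 h4 => by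
    have := hL a ℓ h1 h2 h3 h4; omega
  obtain ⟨hF, hU⟩ := dual_invariant hm hL
  obtain ⟨a, ℓ, ha, hℓ, h0, hlen, hap, hpℓ, hℓp, hend⟩ := hp.exists_isAltSeq hM hL hv ht.le
  obtain ⟨n, hn, hg, hnev, hnod⟩ := hopt.exists_tight_matching ha hℓ h0 hlen
  have hUn := ((dual_weak_duality hm hF hU hn).2 hg).2 s hs
  have hUm := hU s hs
  set r := (blossom G (mate M) (dual G (mate M) s)).r with hr
  have hrsymm : ∀ {x y}, r x y → r y x := fun h => Setoid.symm' _ h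
  have hrtrans : ∀ {x y z}, r x y → r y z → r x z := fun h h' => Setoid.trans' _ h h'
  obtain ⟨i, rfl, hi⟩ := SimpleGraph.Walk.mem_support_iff_exists_getVert.1 hu
  by_contra hcp
  have hca : ∀ j ≤ p.length, a j ≠ c := fun j hj e =>
    hcp (by rw [← e, hap j hj]; exact p.getVert_mem_support j)
  set S := (Finset.range (ℓ + 1)).filter fun j => r (a j) c ∧ a j ≠ c with hS
  have hmemS : ∀ j, j ∈ S ↔ j ≤ ℓ ∧ r (a j) c ∧ a j ≠ c := by
    intro j; simp [hS]
  have hiS : i ∈ S := (hmemS i).2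
    ⟨by omega, by rw [hap i hi]; exact hrsymm hcu, hca i hi⟩
  have hmate : ∀ j ∈ S, mate M (a j) ≠ a j ∧ r (a j) (mate M (a j)) ∧ mate M (a j) ≠ c := by
    intro j hj
    obtain ⟨-, h1, h2⟩ := (hmemS j).1 hj
    have hnd : ¬ IsDeficit r (mate M) (a j) := fun hd => h2 (hUm _ _ h1 hd hcd)
    rw [IsDeficit, not_or, not_not] at hnd
    refine ⟨hnd.1, hnd.2, fun e => ?_⟩
    have hmc : mate M c = a j := by rw [← e, hm.invol]
    rcases hcd with hd | hd
    · exact h2 (by rw [← hmc, hd])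
    · exact hd (by rw [hmc]; exact hrsymm h1)
  have hmateS : ∀ j ∈ S, ∀ k ≤ ℓ, mate M (a j) = a k → k ∈ S := by
    intro j hj k hk e
    obtain ⟨-, h1, h2⟩ := hmate j hj
    rw [e] at h1 h2
    exact (hmemS k).2 ⟨hk, hrtrans (hrsymm h1) ((hmemS j).1 hj).2.1, h2⟩
  have hℓS : ℓ ∉ S := by
    intro hj
    obtain ⟨h1, h2, -⟩ := hmate ℓ hj
    obtain ⟨h3, h4⟩ := outer_of_blossom h2 h1.symm
    have : tenacity M v + 1 ≤ ((2 * s : ℕ) : ℕ∞) := by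
      refine (tenacity_add_one_le_iff hM hLs hv).2 ?_
      rcases hend with h | h
      · rw [← h]; exact ⟨h3, h4⟩
      · rw [← h]
        rw [h, hm.invol] at h4
        exact ⟨h4, h3⟩
    rw [ht] at this
    have : 2 * Δ ≤ 2 * s := by exact_mod_cast this
    omega
  have h0S : 0 ∉ S := fun hj => (hmate 0 hj).1 h0
  have hne : S.Nonempty := ⟨i, hiS⟩
  have hmaxS := S.max'_mem hne
  have hminS := S.min'_mem hne
  set i₁ := S.max' hne with hi₁
  set i₀ := S.min' hne with hi₀
  have hmax : ∀ j ∈ S, j ≤ i₁ := fun j hj => S.le_max' j hj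
  have hmin : ∀ j ∈ S, i₀ ≤ j := fun j hj => S.min'_le j hj
  have hi₁ℓ : i₁ < ℓ := lt_of_le_of_ne ((hmemS _).1 hmaxS).1 fun e => hℓS (e ▸ hmaxS)
  have hi₀ℓ : i₀ ≤ ℓ := ((hmemS _).1 hminS).1
  have hi₀0 : i₀ ≠ 0 := fun e => h0S (e ▸ hminS)
  have hev₁ : Even i₁ := by
    by_contra hc
    have := hmax _ (hmateS i₁ hmaxS (i₁ + 1) hi₁ℓ (ha.odd i₁ hi₁ℓ (Nat.not_even_iff_odd.1 hc)))
    omega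
  obtain ⟨k, hk⟩ := Nat.exists_eq_succ_of_ne_zero hi₀0
  have hevk : Even k := by
    by_contra hc
    have := hmin _ (hmateS i₀ hminS k (by omega) (by
      rw [hk]; exact ha.odd_succ hm.invol (by omega) (Nat.not_even_iff_odd.1 hc)))
    omega
  have hr₁ := ((hmemS _).1 hmaxS).2.1
  have hr₀ := ((hmemS _).1 hminS).2.1
  have hd₁ : IsDeficit r n (a i₁) := by
    right
    rw [hnev i₁ hi₁ℓ hev₁]
    intro hrel
    have hne' : i₁ + 1 ≠ ℓ := fun e => Nat.not_even_iff_odd.2 hev₁.add_one (e ▸ hℓ)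
    have := hmax (i₁ + 1) ((hmemS _).2
      ⟨hi₁ℓ, hrtrans (hrsymm hrel) hr₁, hca _ (by omega)⟩)
    omega
  have hd₀ : IsDeficit r n (a i₀) := by
    right
    have hna : n (a i₀) = a k := by rw [hk]; exact hnod k (by omega) hevk
    rw [hna]
    intro hrel
    have := hmin k ((hmemS _).2 ⟨by omega, hrtrans (hrsymm hrel) hr₀, hca _ (by omega)⟩)
    omega
  have heq := ha.inj _ hi₁ℓ.le _ hi₀ℓ (hUn _ _ (hrtrans hr₁ (hrsymm hr₀)) hd₁ hd₀)
  exact Nat.not_even_iff_odd.2 hevk.add_one (by rw [heq, hk] at hev₁; exact hev₁)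

/-- A vertex of at least the tenacity of `v` on a level path of `v` is reached by that path in the
shortest possible way. -/
theorem IsLevelPath.take (hM : M.IsMatching) (hL : NoShortAugmentation G (mate M) Δ)
    {f v : V} {p : G.Walk f v} (hp : IsLevelPath M p) (hv : mate M v ≠ v)
    (ht : tenacity M v + 1 = ((2 * Δ : ℕ) : ℕ∞)) {i : ℕ} (hi : i ≤ p.length)
    (hu : mate M (p.getVert i) ≠ p.getVert i) (hle : tenacity M v ≤ tenacity M (p.getVert i)) :
    IsLevelPath M (p.take i) := by
  have hm := isMate_mate hM
  have hopt := isOptimal_dual hm hL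
  obtain ⟨a, ℓ, ha, hℓ, h0, hlen, hap, hpℓ, hℓp, hend⟩ := hp.exists_isAltSeq hM hL hv ht.le
  obtain ⟨hf, halt⟩ : Unmatched M f ∧ IsAltPath M p := by
    rcases hp with h | h <;> exact ⟨h.1, h.2.1⟩
  have halt' : IsAltPath M (p.take i) :=
    ⟨halt.1.take i, by rw [SimpleGraph.Walk.edges_take]; exact halt.2.take i⟩
  have hlen' : (p.take i).length = i := by rw [SimpleGraph.Walk.take_length]; omega
  have hz : (dual G (mate M) Δ).z (p.getVert i) (mate M (p.getVert i)) = 0 := by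
    refine dual_z_eq_zero_of_lt hM hL le_rfl hu ?_
    rw [← ht]; gcongr
  rcases Nat.even_or_odd i with he | ho
  · obtain ⟨h1, h2⟩ := hopt.outer_prefix ha hℓ h0 hlen (k := i) (by omega) he
      (.inr (by rwa [hap i hi]))
    rw [hap i hi] at h1 h2
    obtain ⟨k, hk, hk'⟩ := evenlevel_of_outer hM hopt h1
    refine .inl ⟨hf, halt', by rwa [hlen'], ?_⟩
    have : i = k := by omega
    rw [hlen', hk, this]
  · have hiℓ : i < ℓ := lt_of_le_of_ne (by omega) fun e => Nat.not_even_iff_odd.2 ho (e ▸ hℓ)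
    have hmi := ha.odd i hiℓ ho
    rw [hap i hi] at hmi
    obtain ⟨h1, h2⟩ := hopt.outer_prefix ha hℓ h0 hlen (k := i + 1) hiℓ ho.add_one
      (.inr (by rw [← hmi, hm.invol, dual_z_symm]; exact hz))
    rw [← hmi] at h1 h2
    obtain ⟨k, hk, hk'⟩ := evenlevel_of_outer hM hopt h1
    rw [evenlevel_mate hM hu] at hk
    refine .inr ⟨hf, halt', by rwa [hlen'], ?_⟩
    have : i + 1 = k := by omega
    rw [← this] at hk
    push_cast at hk
    rw [hlen']
    exact le_antisymm ((ENat.add_le_add_iff_right ENat.one_ne_top).1 hk.ge)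
      ((ENat.add_le_add_iff_right ENat.one_ne_top).1 hk.le)

omit [Fintype V] [DecidableEq V] in
/-- Every level path of a vertex of tenacity less than `l_m` has a base. -/
theorem exists_isBaseWrt (hM : M.IsMatching) {f v : V} {p : G.Walk f v} (hf : Unmatched M f)
    (hv : tenacity M v < augLength M) : ∃ b, IsBaseWrt M p b := by
  classical
  have h0 : tenacity M v < tenacity M (p.getVert 0) := by
    rw [p.getVert_zero]
    exact hv.trans_le (augLength_le_tenacity hM ((unmatched_iff hM).1 hf))
  refine ⟨_, Nat.findGreatest (fun i => tenacity M v < tenacity M (p.getVert i)) p.length,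
    Nat.findGreatest_le _, rfl,
    Nat.findGreatest_spec (P := fun i => tenacity M v < tenacity M (p.getVert i))
      (Nat.zero_le _) h0, fun j hj hij => Nat.findGreatest_is_greatest hij hj⟩

/-- A level path of a vertex of tenacity less than `l_m` contains the base of each of its
vertices. -/
theorem base_mem_support (hM : M.IsMatching) {f v u c : V} {p : G.Walk f v}
    (hp : IsLevelPath M p) (hv : tenacity M v < augLength M) (hu : u ∈ p.support)
    (hc : IsBase M u c) : c ∈ p.support := by
  have hvm := mate_ne_of_tenacity_lt hM hv
  have hum := mate_ne_of_tenacity_lt hM hc.1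
  obtain ⟨Δ, ht, hΔ⟩ := exists_two_mul_eq hM hv
  obtain ⟨s, hts, hs⟩ := exists_two_mul_eq hM hc.1
  have hL := noShortAugmentation hM hΔ
  rcases lt_or_ge (tenacity M u) (tenacity M v) with hlt | hle
  · have hmem : c ∈ baseSet M u := by rw [hc.2]; rfl
    obtain ⟨g, q, hq, hqc⟩ := hmem
    obtain ⟨hcu, hcd⟩ := hqc.isDeficit hM (noShortAugmentation hM hs) hq hum hts
    have hsΔ : s < Δ := by
      have : tenacity M u + 1 < tenacity M v + 1 :=
        (ENat.add_lt_add_iff_right ENat.one_ne_top).2 hlt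
      rw [ht, hts] at this
      have : 2 * s < 2 * Δ := by exact_mod_cast this
      omega
    exact deficit_mem_support hM hL hsΔ hp hvm ht hu hcu hcd
  · obtain ⟨i, rfl, hi⟩ := SimpleGraph.Walk.mem_support_iff_exists_getVert.1 hu
    have htake := hp.take hM hL hvm ht hi hum hle
    have hf : Unmatched M f := by rcases hp with h | h <;> exact h.1
    obtain ⟨b, hb⟩ := exists_isBaseWrt hM (p := p.take i) hf hc.1
    have hbc : b ∈ baseSet M (p.getVert i) := ⟨f, p.take i, htake, hb⟩
    rw [hc.2, Set.mem_singleton_iff] at hbc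
    obtain ⟨j, -, hj, -, -⟩ := hb
    rw [← hbc, ← hj, SimpleGraph.Walk.take_getVert]
    exact p.getVert_mem_support _

omit [Fintype V] [DecidableEq V] in
theorem IsIterBase.exists_isBase {k : ℕ} {v b : V} (h : IsIterBase M (k + 1) v b) :
    ∃ c, IsBase M v c := by
  induction k generalizing b with
  | zero =>
    obtain ⟨c, hc, hb⟩ := h
    rw [IsIterBase] at hc
    exact ⟨b, hc ▸ hb⟩
  | succ k ih =>
    obtain ⟨c, hc, -⟩ := h
    exact ih hc

end Bases

end AltPath

theorem mainTheorem5 {V : Type*} [Finite V] (G : SimpleGraph V) (M : G.Subgraph)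
    (hM : M.IsMatching) (v : V) (hv : AltPath.HasAllIterBases M v)
    (f : V) (p : G.Walk f v) (hp : AltPath.IsLevelPath M p)
    (u : V) (hu : u ∈ p.support) (k : ℕ) (hk : 1 ≤ k) (b : V) (hb : AltPath.IsIterBase M k u b) :
    b ∈ p.support := by
  classical
  have := Fintype.ofFinite V
  have hlt : AltPath.tenacity M v < AltPath.augLength M := by
    obtain ⟨j, hj, c, hc, -⟩ := hv
    obtain ⟨j, rfl⟩ := Nat.exists_eq_add_of_le' hj
    obtain ⟨d, hd⟩ := hc.exists_isBase
    exact hd.1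
  clear hk
  induction k generalizing b with
  | zero =>
    rw [AltPath.IsIterBase] at hb
    rwa [hb]
  | succ k ih =>
    obtain ⟨c, hc, hcb⟩ := hb
    exact AltPath.base_mem_support hM hp hlt (ih c hc) hcb
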